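/- Throughout, $[n]=\{1,\dots,n\}$ and $\mathfrak S_n$ is the set of permutations of $[n]$, written in one-line notation. **Maximal nestings.** Let $\mathsf T$ be a rooted plane tree with $n+1$ vertices, its vertex set being identified with $\{0,1,\dots,n\}$ so that $0,1,\dots,n$ is the preorder traversal of $\mathsf T$, and let $\le_{\mathsf T}$ be the partial order on the vertices in which the root $0$ is the minimum and each other vertex covers its parent. A *tube* is a set of vertices that induces a connected subgraph; its *root* is its $\le_{\mathsf T}$-minimum. A *nesting* is a collection of tubes, each with at least $2$ elements, that contains the tube $\{0,\dots,n\}$ and in which any two tubes are nested or disjoint. Let $\mathrm{MN}(\mathsf T)$ be the set of nestings that are maximal under containment. For $\mathcal N,\mathcal N'\in\mathrm{MN}(\mathsf T)$ write $\mathcal N\lessdot\mathcal N'$ if there are $\tau\in\mathcal N\setminus\mathcal N'$ and $\tau'\in\mathcal N'\setminus\mathcal N$ such that $\mathcal N\setminus\{\tau\}=\mathcal N'\setminus\{\tau'\}$ and every element of $\tau\setminus\tau'$ is less than every element of $\tau'\setminus\tau$ in $\mathbb Z$. The set $\mathrm{MN}(\mathsf T)$, ordered by the reflexive and transitive closure of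 $\lessdot$, is the *operahedron lattice* of $\mathsf T$. For $1\le k\le n$, the *broom* $\mathsf{Broom}_{k,n}$ is the tree on $\{0,\dots,n\}$ consisting of the chain $0<1<\cdots<n-k$ and $k$ leaves $n-k+1,\dots,n$ whose parent is $n-k$. **Weak order and stack-sorting.** For $w\in\mathfrak S_n$ let $\mathrm{Inv}(w)=\{(i,j):1\le i<j\le n,\ w^{-1}(j)<w^{-1}(i)\}$. The weak order $\mathrm{Weak}(\mathfrak S_n)$ is the partial order on $\mathfrak S_n$ with $w\le w'$ if and only if $\mathrm{Inv}(w)\subseteq\mathrm{Inv}(w')$, and $\Delta_{\mathrm{Weak}(\mathfrak S_n)}(w)=\{u\in\mathfrak S_n:u\le w\}$. West's stack-sorting map $\mathtt s$ is defined on words with distinct letters by $\mathtt s(\epsilon)=\epsilon$ for the empty word $\epsilon$ and $\mathtt s(\mathsf L\,m\,\mathsf R)=\mathtt s(\mathsf L)\,\mathtt s(\mathsf R)\,m$, where $m$ is the largest letter; it restricts to a map $\mathfrak S_n\to\mathfrak S_n$. Let $w_\circ(k,n)=k(k-1)\cdots1(k+1)(k+2)\cdots n\in\mathfrak S_n$.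 **Theorem.** Let $1\le k\le n$ be integers. The poset $\mathrm{MN}(\mathsf{Broom}_{k,n})$ is isomorphic to the subposet $\mathtt s^{-1}\bigl(\Delta_{\mathrm{Weak}(\mathfrak S_n)}(w_\circ(k,n))\bigr)$ of $\mathrm{Weak}(\mathfrak S_n)$. Moreover, an isomorphism is given explicitly as follows. Let $\mathcal N\in\mathrm{MN}(\mathsf{Broom}_{k,n})$. There is a unique linear extension of $\le_{\mathsf{Broom}_{k,n}}$ in which the elements of each tube of $\mathcal N$ form a consecutive factor; let $\lambda=w_1\cdots w_n$ be the word obtained from it by deleting its first letter (which is $0$). For each vertex $v\ne0$ let $\varrho(v)$ be the largest tube in $\mathcal N$ with root $v$, or $\{v\}$ if there is no such tube. For $u\in[n]$ let $A(u)=\{j\in[n]:u\in\varrho(n+1-j)\}$, and for $1\le\ell\le n$ let $\mu(w_\ell)$ be the word that lists the elements of $A(w_\ell)\setminus\bigcup_{i=\ell+1}^nA(w_i)$ in decreasing order. The isomorphism sends $\mathcal N$ to the permutation with one-line notation $\mu(w_n)\mu(w_{n-1})\cdots\mu(w_1)$. -/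

import Mathlib

/-! ## Rooted plane trees and maximal nestings -/

/-- The tree order of a parent function on `{0, …, n}`: `i + 1` has parent `parent i`, the root is
`0`, and `TreeLE parent a b` says that `a` lies on the path from the root to `b`. -/
def TreeLE {n : ℕ} (parent : Fin n → Fin (n + 1)) : Fin (n + 1) → Fin (n + 1) → Prop :=
  Relation.ReflTransGen fun a b => ∃ i : Fin n, b = i.succ ∧ a = parent i

/-- A rooted plane tree with `n + 1` vertices, its vertex set being identified with `{0, …, n}` so
that `0, 1, …, n` is the preorder traversal. The root is `0` and the parent of the vertex `i + 1` is
`parent i`. The labelling is the preorder traversal exactly when the parent of `i + 1` is always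
`i` or an ancestor of `i`; the children of a vertex are ordered from left to right by their
labels. -/
structure PlaneTree (n : ℕ) where
  parent : Fin n → Fin (n + 1)
  preorder : ∀ i : Fin n, TreeLE parent (parent i) i.castSucc

namespace PlaneTree

variable {n : ℕ}

/-- The partial order `≤_T` on the vertices; the root is the minimum. -/
def le (T : PlaneTree n) : Fin (n + 1) → Fin (n + 1) → Prop := TreeLE T.parent

/-- The underlying graph of the tree. -/
def graph (T : PlaneTree n) : SimpleGraph (Fin (n + 1)) :=
  SimpleGraph.fromRel fun a b => ∃ i : Fin n, b = i.succ ∧ a = T.parent i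

/-- A tube is a set of vertices that induces a connected subgraph. -/
def IsTube (T : PlaneTree n) (τ : Finset (Fin (n + 1))) : Prop :=
  (T.graph.induce (τ : Set (Fin (n + 1)))).Connected

/-- `v` is the root (minimal element for `≤_T`) of `τ`. -/
def IsRootOf (T : PlaneTree n) (v : Fin (n + 1)) (τ : Finset (Fin (n + 1))) : Prop :=
  v ∈ τ ∧ ∀ u ∈ τ, T.le v u

/-- Nestings: collections of tubes with at least two vertices, containing the whole vertex set,
any two of which are nested or disjoint. -/
structure IsNesting (T : PlaneTree n) (N : Finset (Finset (Fin (n + 1)))) : Prop where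
  isTube : ∀ τ ∈ N, T.IsTube τ
  univ_mem : Finset.univ ∈ N
  two_le_card : ∀ τ ∈ N, 2 ≤ τ.card
  nested_or_disjoint : ∀ τ ∈ N, ∀ τ' ∈ N, τ ⊆ τ' ∨ τ' ⊆ τ ∨ Disjoint τ τ'

/-- `MN(T)`: the nestings that are maximal under containment. -/
@[ext] structure MaximalNesting (T : PlaneTree n) where
  tubes : Finset (Finset (Fin (n + 1)))
  maximal : Maximal T.IsNesting tubes

namespace MaximalNesting

variable {T : PlaneTree n}

/-- The relation `N ⋖ N'`: the maximal nestings `N` and `N'` are adjacent (each is obtained from the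
other by replacing a single tube, `τ` by `τ'`), and every element of `τ \ τ'` is less, as an integer,
than every element of `τ' \ τ`. -/
def Move (N N' : T.MaximalNesting) : Prop :=
  ∃ τ τ', τ ∈ N.tubes ∧ τ ∉ N'.tubes ∧ τ' ∈ N'.tubes ∧ τ' ∉ N.tubes ∧
    N.tubes.erase τ = N'.tubes.erase τ' ∧ ∀ a ∈ τ \ τ', ∀ b ∈ τ' \ τ, a < b

/-- A statistic on maximal nestings that strictly decreases along moves. -/
def weight (N : T.MaximalNesting) : ℕ := ∑ τ ∈ N.tubes, ∑ x ∈ τ, 2 ^ (n - (x : ℕ))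

theorem Move.weight_lt {N N' : T.MaximalNesting} (h : Move N N') : N'.weight < N.weight := by
  obtain ⟨τ, τ', hτ, hτN', hτ', hτ'N, he, hlt⟩ := h
  -- neither tube contains the other, by maximality
  have hne : (τ \ τ').Nonempty := by
    rw [Finset.sdiff_nonempty]
    intro hsub
    have hmem : ∀ σ ∈ N.tubes, σ = τ ∨ σ ∈ N'.tubes := by
      intro σ hσ
      by_cases h : σ = τ
      · exact Or.inl h
      · exact Or.inr (Finset.mem_of_mem_erase (he ▸ Finset.mem_erase.2 ⟨h, hσ⟩))
    have hN := N.maximal.prop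
    have hN' := N'.maximal.prop
    have hcomp : ∀ σ ∈ N.tubes, σ ⊆ τ' ∨ τ' ⊆ σ ∨ Disjoint σ τ' := by
      intro σ hσ
      rcases hmem σ hσ with rfl | h
      · exact Or.inl hsub
      · exact hN'.nested_or_disjoint σ h τ' hτ'
    have hins : T.IsNesting (insert τ' N.tubes) := by
      refine ⟨?_, Finset.mem_insert_of_mem hN.univ_mem, ?_, ?_⟩
      · intro σ hσ
        rcases Finset.mem_insert.1 hσ with rfl | h
        · exact hN'.isTube _ hτ'
        · exact hN.isTube _ h
      · intro σ hσ
        rcases Finset.mem_insert.1 hσ with rfl | h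
        · exact hN'.two_le_card _ hτ'
        · exact hN.two_le_card _ h
      · intro σ hσ ρ hρ
        rcases Finset.mem_insert.1 hσ with rfl | h <;> rcases Finset.mem_insert.1 hρ with rfl | h'
        · exact Or.inl subset_rfl
        · rcases hcomp ρ h' with h1 | h1 | h1
          · exact Or.inr (Or.inl h1)
          · exact Or.inl h1
          · exact Or.inr (Or.inr h1.symm)
        · exact hcomp σ h
        · exact hN.nested_or_disjoint σ h ρ h'
    exact hτ'N (N.maximal.le_of_ge hins (Finset.subset_insert _ _) (Finset.mem_insert_self _ _))
  have key : ∀ (m : ℕ) (B : Finset (Fin (n + 1))), (∀ b ∈ B, m < (b : ℕ)) → m ≤ n →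
      ∑ x ∈ B, 2 ^ (n - (x : ℕ)) < 2 ^ (n - m) := by
    intro m B hB hm
    have hinj : Set.InjOn (fun x : Fin (n + 1) => n - (x : ℕ)) B := by
      intro x _ y _ hxy
      have hx := x.isLt
      have hy := y.isLt
      simp only at hxy
      exact Fin.ext (by omega)
    rw [← Finset.sum_image (f := fun i => 2 ^ i) hinj]
    refine Nat.geomSum_lt (le_refl 2) ?_
    intro k hk
    obtain ⟨b, hb, rfl⟩ := Finset.mem_image.1 hk
    have := hB b hb
    have := b.isLt
    omega
  obtain ⟨a, ha⟩ := hne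
  have h1 : ∑ x ∈ τ' \ τ, 2 ^ (n - (x : ℕ)) < ∑ x ∈ τ \ τ', 2 ^ (n - (x : ℕ)) :=
    (key a _ (fun b hb => hlt a ha b hb) (by omega)).trans_le
      (Finset.single_le_sum (f := fun x : Fin (n + 1) => 2 ^ (n - (x : ℕ)))
        (fun _ _ => Nat.zero_le _) ha)
  have h2 := Finset.sum_inter_add_sum_sdiff τ τ' fun x => 2 ^ (n - (x : ℕ))
  have h3 := Finset.sum_inter_add_sum_sdiff τ' τ fun x => 2 ^ (n - (x : ℕ))
  rw [Finset.inter_comm] at h3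
  have h4 := Finset.add_sum_erase N.tubes (fun σ => ∑ x ∈ σ, 2 ^ (n - (x : ℕ))) hτ
  have h5 := Finset.add_sum_erase N'.tubes (fun σ => ∑ x ∈ σ, 2 ^ (n - (x : ℕ))) hτ'
  rw [he] at h4
  unfold weight
  omega

theorem eq_or_weight_lt {N N' : T.MaximalNesting} (h : Relation.ReflTransGen Move N N') :
    N = N' ∨ N'.weight < N.weight := by
  induction h with
  | refl => exact Or.inl rfl
  | tail _ hm ih =>
    rcases ih with rfl | ih
    · exact Or.inr hm.weight_lt
    · exact Or.inr (hm.weight_lt.trans ih)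

/-- The order on `MN(T)`: the reflexive and transitive closure of the moves. -/
instance : PartialOrder T.MaximalNesting where
  le := Relation.ReflTransGen Move
  le_refl _ := Relation.ReflTransGen.refl
  le_trans _ _ _ := Relation.ReflTransGen.trans
  le_antisymm N N' h h' := by
    rcases eq_or_weight_lt h with e | e
    · exact e
    · rcases eq_or_weight_lt h' with e' | e'
      · exact e'.symm
      · exact absurd e (lt_asymm e')

open Classical in
/-- `ϱ_N(v)`: the largest tube in `N` with root `v`, and `{v}` if there is none. (The tubes in `N`
with root `v` all contain `v`, so they form a chain and their union is the largest of them.) -/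
noncomputable def ornament (N : T.MaximalNesting) (v : Fin (n + 1)) : Finset (Fin (n + 1)) :=
  {v} ∪ (N.tubes.filter fun τ => T.IsRootOf v τ).biUnion id

/-- `L` is a linear extension of `T` (a word that contains each vertex once, every vertex coming
after its `≤_T`-predecessors) in which the elements of each tube of `N` form a consecutive
factor. -/
def IsLinearization (N : T.MaximalNesting) (L : List (Fin (n + 1))) : Prop :=
  L.Nodup ∧ (∀ v, v ∈ L) ∧ L.Pairwise (fun a b => ¬ T.le b a) ∧
    ∀ τ ∈ N.tubes, ∃ F : List (Fin (n + 1)), F <:+: L ∧ F.toFinset = τ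

end MaximalNesting

/-- The broom `Broom_{k,n}`: the chain `0 < 1 < ⋯ < n - k`, with `k` leaves `n - k + 1, …, n`
attached to its top vertex `n - k`. -/
def broom (k n : ℕ) : PlaneTree n where
  parent i := ⟨min i (n - k), by omega⟩
  preorder i := by
    obtain ⟨i, hi⟩ := i
    rcases Nat.lt_or_ge (n - k) i with h | h
    · refine Relation.ReflTransGen.single ⟨⟨i - 1, by omega⟩, ?_, ?_⟩
      · ext
        simp
        omega
      · ext
        simp
        omega
    · have e : (⟨min i (n - k), by omega⟩ : Fin (n + 1)) = Fin.castSucc ⟨i, hi⟩ := by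
        ext
        simpa using h
      simp only [e]
      exact Relation.ReflTransGen.refl

end PlaneTree

/-! ## The weak order and the stack-sorting map

The letters `1, …, n` are represented by the elements `0, …, n - 1` of `Fin n`. -/

/-- Permutations of `n` letters, as the ground set of the (right) weak order. -/
def Weak (n : ℕ) : Type := Equiv.Perm (Fin n)

namespace Weak

variable {n : ℕ}

/-- The permutation underlying an element of `Weak n`. -/
def perm (w : Weak n) : Equiv.Perm (Fin n) := w

/-- One-line notation `w(1) ⋯ w(n)`. -/
def oneLine (w : Weak n) : List (Fin n) := List.ofFn w.perm

/-- The inversions `(i, j)` of `w`: `i < j` and `w⁻¹(j) < w⁻¹(i)`. -/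
def inversions (w : Weak n) : Set (Fin n × Fin n) :=
  {p | p.1 < p.2 ∧ w.perm.symm p.2 < w.perm.symm p.1}

theorem inversions_injective : Function.Injective (inversions (n := n)) := by
  intro u v h
  have hlt : ∀ i j : Fin n, u.perm.symm i < u.perm.symm j → v.perm.symm i < v.perm.symm j := by
    intro i j hij
    rcases lt_trichotomy i j with hl | rfl | hl
    · by_contra hc
      have hne : v.perm.symm i ≠ v.perm.symm j := fun e => hl.ne (v.perm.symm.injective e)
      have : (i, j) ∈ v.inversions := ⟨hl, lt_of_le_of_ne (not_lt.1 hc) hne.symm⟩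
      rw [← h] at this
      exact lt_asymm hij this.2
    · exact absurd hij (lt_irrefl _)
    · have : (j, i) ∈ u.inversions := ⟨hl, hij⟩
      rw [h] at this
      exact this.2
  have hmono : StrictMono (fun x : Fin n => v.perm.symm (u.perm x)) := by
    intro x y hxy
    exact hlt _ _ (by simpa using hxy)
  have hid : ∀ x, v.perm.symm (u.perm x) = x := by
    have h1 := Subsingleton.elim (hmono.orderIsoOfSurjective _
      (fun y => ⟨u.perm.symm (v.perm y), by simp⟩)) (OrderIso.refl (Fin n))
    intro x
    exact DFunLike.congr_fun h1 x
  exact Equiv.ext fun x => ((Equiv.symm_apply_eq _).1 (hid x))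

/-- The weak order: containment of inversion sets. -/
instance : PartialOrder (Weak n) := PartialOrder.lift inversions inversions_injective

/-- `w_∘(k, n) = k (k-1) ⋯ 1 (k+1) ⋯ n`. -/
def wCirc (k n : ℕ) (hkn : k ≤ n) : Weak n :=
  Function.Involutive.toPerm
    (fun i : Fin n => if h : (i : ℕ) < k then ⟨k - 1 - i, by omega⟩ else i) (by
      intro i
      by_cases h : (i : ℕ) < k
      · have h' : k - 1 - (i : ℕ) < k := by omega
        simp only [h, h', dite_true]
        ext
        simp
        omega
      · simp [h])

end Weak

/-- West's stack-sorting map on words without repeated letters: `s(ε) = ε`, and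
`s(L m R) = s(L) s(R) m`, where `m` is the largest letter. -/
def stackSort {α : Type*} [LinearOrder α] (w : List α) : List α :=
  if h : 0 < w.length then
    let m := w.maximum_of_length_pos h
    stackSort (w.take (w.idxOf m)) ++ stackSort (w.drop (w.idxOf m + 1)) ++ [m]
  else []
termination_by w.length
decreasing_by
  · have := List.idxOf_lt_length_of_mem (List.maximum_of_length_pos_mem h)
    simp only [List.length_take]
    omega
  · simp only [List.length_drop]
    omega

theorem stackSort_perm {α : Type*} [LinearOrder α] (w : List α) : (stackSort w).Perm w := by
  induction hl : w.length using Nat.strong_induction_on generalizing w with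
  | _ l ih =>
    subst hl
    rw [stackSort]
    split
    · rename_i h
      have hm := List.maximum_of_length_pos_mem h
      generalize w.maximum_of_length_pos h = m at hm
      have hi := List.idxOf_lt_length_of_mem hm
      have h1 := ih _ (by simp only [List.length_take]; omega) (w.take (w.idxOf m)) rfl
      have h2 := ih _ (by simp only [List.length_drop]; omega) (w.drop (w.idxOf m + 1)) rfl
      have e : w = w.take (w.idxOf m) ++ (m :: w.drop (w.idxOf m + 1)) := by
        conv_lhs => rw [← List.take_append_drop (w.idxOf m) w, List.drop_eq_getElem_cons hi]
        simp
      refine ((h1.append h2).append_right [m]).trans ?_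
      conv_rhs => rw [e]
      rw [List.append_assoc]
      exact (List.perm_append_singleton _ _).append_left _
    · rename_i h
      have : w = [] := List.eq_nil_of_length_eq_zero (by omega)
      simp [this]

namespace Weak

variable {n : ℕ}

theorem stackSort_oneLine_length (w : Weak n) : (stackSort w.oneLine).length = n := by
  rw [(stackSort_perm _).length_eq]
  simp [oneLine]

theorem stackSort_oneLine_nodup (w : Weak n) : (stackSort w.oneLine).Nodup :=
  (stackSort_perm _).nodup_iff.2 (List.nodup_ofFn.2 w.perm.injective)

/-- West's stack-sorting map as a map on permutations: the `i`-th letter of `s(w)` is the `i`-th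
letter of the word obtained by stack-sorting the one-line notation of `w`. -/
noncomputable def sort (w : Weak n) : Weak n :=
  Equiv.ofBijective
    (fun i : Fin n => (stackSort w.oneLine).get (i.cast w.stackSort_oneLine_length.symm))
    (Finite.injective_iff_bijective.1 fun i j h => by
      have := List.nodup_iff_injective_get.1 w.stackSort_oneLine_nodup h
      exact Fin.ext (by simpa using congrArg Fin.val this))

/-- The subposet `s⁻¹(Δ(w_∘(k, n)))` of the weak order, where `Δ(w)` is the principal order ideal
generated by `w`. -/
def stackSortPreimage (k n : ℕ) (hkn : k ≤ n) : Set (Weak n) :=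
  Weak.sort ⁻¹' Set.Iic (wCirc k n hkn)

end Weak

/-! ## The explicit map -/

/-- The word `μ(u)` for a word `lam` on the non-root vertices and a family of sets `rho`: the letters
`j` with `u ∈ rho (n + 1 - j)` and `w ∉ rho (n + 1 - j)` for all `w` to the right of `u` in `lam`, in
decreasing order. The letter `j` being represented by `j - 1 : Fin n`, the vertex `n + 1 - j` is
`(Fin.rev (j - 1)).succ`. -/
def omegaBlock {n : ℕ} (lam : List (Fin (n + 1))) (rho : Fin (n + 1) → Finset (Fin (n + 1)))
    (u : Fin (n + 1)) : List (Fin n) :=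
  (Finset.univ.filter fun j : Fin n => u ∈ rho j.rev.succ ∧
    ∀ w ∈ lam, lam.idxOf u < lam.idxOf w → w ∉ rho j.rev.succ).sort (· ≥ ·)

/-- The word `Ω(lam, rho) = μ(w_n) μ(w_{n-1}) ⋯ μ(w_1)`, where `lam = w_1 ⋯ w_n`. -/
def omegaWord {n : ℕ} (lam : List (Fin (n + 1))) (rho : Fin (n + 1) → Finset (Fin (n + 1))) :
    List (Fin n) :=
  lam.reverse.flatMap (omegaBlock lam rho)

/-! Call `i` the edge joining `i + 1` to its parent. In a nesting `N` each edge has a smallest tube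
`split N i` around it, and `N` is maximal exactly when `split` is injective (`split_injective`,
`IsNesting.maximal`); every tube of a maximal nesting is then the split of exactly one edge. The
pairs `i < j` with `j + 1` in `split N i` play the role of inversions, and a move can only add
inversions (`Move.inv`).

For a broom these pairs are transitive and co-transitive (`Inv.trans`, `broom_inv_or_inv`), hence
they form the inversion set of a permutation `N.toWeak`, the letter `j` standing for the edge
`j.rev`. A chain vertex lies below everything labelled after it, so for `a < b < c` with `b` a chain
edge (`b < n - k`) the inversion `(a, c)` forces `(a, b)`. In terms of letters this forbids `b c a`
with `a < b < c` and `b > k`. Since `b` precedes `a` in the stack-sorted word exactly when a letter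
larger than `b` separates them in `w`, the condition says that the stack-sorted permutation lies
below `wCirc` (`mem_stackSortPreimage_iff`).

The converse is a descent. If `w` satisfies this condition and its inversions are properly contained
in those of `N`, some inversion of `N.toWeak` between adjacent letters is absent from `w`, and a
move `M ⋖ N` undoes it while keeping all inversions of `w` (`exists_move`,
`exists_move_of_edgeInv`). Iteration ends at a nesting with exactly the inversions of `w`. Started
at the nesting with all inversions, this gives surjectivity; started at `N` with `w = M.toWeak`, it
gives `M ≤ N`, because inversions determine the nesting (`eq_of_inv`).

For the explicit word, the linearization must list the chain and then the leaves in the order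
opposite to `Before`. The order `Before` then compares edges by the last vertex of their ornaments,
later vertices first and ties broken by label (`before_of_linKey_le`), which is how `omegaWord` is
assembled. -/

namespace PlaneTree

/-! ### The tree order and the preorder labels. -/

variable {n : ℕ} (T : PlaneTree n)

theorem fin_le_of_le {a b : Fin (n + 1)} (hab : T.le a b) : a ≤ b := by
  induction hb : (b : ℕ) using Nat.strong_induction_on generalizing a b with
  | _ m ih =>
    subst hb
    rcases Relation.ReflTransGen.cases_tail hab with rfl | ⟨c, hac, j, rfl, rfl⟩
    · exact le_rfl
    · have h1 : T.parent j ≤ j.castSucc := ih _ (by simp) (T.preorder j) rfl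
      have h1' : (T.parent j : ℕ) ≤ j := h1
      have h2 : a ≤ T.parent j := ih (T.parent j) (by simp; omega) hac rfl
      have h2' : (a : ℕ) ≤ T.parent j := h2
      exact Fin.le_def.2 (by simp; omega)

theorem parent_lt (i : Fin n) : T.parent i < i.succ :=
  (T.fin_le_of_le (T.preorder i)).trans_lt (Fin.castSucc_lt_succ)

theorem le_refl (a : Fin (n + 1)) : T.le a a := Relation.ReflTransGen.refl

theorem not_le_parent (i : Fin n) : ¬ T.le i.succ (T.parent i) := fun h =>
  absurd (T.fin_le_of_le h) (not_le.2 (T.parent_lt i))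

theorem le_succ_iff {a : Fin (n + 1)} {i : Fin n} :
    T.le a i.succ ↔ a = i.succ ∨ T.le a (T.parent i) := by
  constructor
  · intro h
    rcases Relation.ReflTransGen.cases_tail h with h | ⟨c, hac, j, hj, rfl⟩
    · exact Or.inl h.symm
    · rw [Fin.succ_inj] at hj
      subst hj
      exact Or.inr hac
  · rintro (rfl | h)
    · exact T.le_refl _
    · exact h.tail ⟨i, rfl, rfl⟩

theorem le_succ_iff_of_ne {i j : Fin n} (h : i ≠ j) :
    T.le j.succ i.succ ↔ T.le j.succ (T.parent i) := by
  rw [le_succ_iff, Fin.succ_inj]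
  simp [h.symm]

/-! ### Tubes -/

/-- The only edge leaving the subtree above `i + 1` goes to the parent of `i + 1`. If that parent is
missing from `τ`, a walk in `τ` from `i + 1` stays in the subtree, so `i + 1` is the least label of
`τ`. Conversely, passing to parents connects every vertex to the root. -/
theorem isTube_iff {τ : Finset (Fin (n + 1))} :
    T.IsTube τ ↔ ∃ r ∈ τ, (∀ x ∈ τ, r ≤ x) ∧
      ∀ i : Fin n, i.succ ∈ τ → i.succ ≠ r → T.parent i ∈ τ := by
  constructor
  · intro h
    have hne : τ.Nonempty := by
      obtain ⟨x⟩ := h.nonempty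
      exact ⟨x.1, x.2⟩
    refine ⟨τ.min' hne, τ.min'_mem hne, fun x hx => τ.min'_le x hx, fun i hi hir => ?_⟩
    by_contra hp
    have key : ∀ y : (τ : Set (Fin (n + 1))),
        (T.graph.induce (τ : Set (Fin (n + 1)))).Reachable ⟨i.succ, hi⟩ y → T.le i.succ y.1 := by
      rintro y ⟨w⟩
      have : ∀ (a b : (τ : Set (Fin (n + 1))))
          (w : (T.graph.induce (τ : Set (Fin (n + 1)))).Walk a b),
          T.le i.succ a.1 → T.le i.succ b.1 := by
        intro a b w
        induction w with
        | nil => exact id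
        | @cons a b c hab _ ih =>
          intro ha
          apply ih
          simp only [SimpleGraph.comap_adj, graph, SimpleGraph.fromRel_adj] at hab
          obtain ⟨-, ⟨j, hb, ha'⟩ | ⟨j, ha', hb⟩⟩ := hab
          · rw [Function.Embedding.subtype_apply] at ha' hb
            rw [hb, le_succ_iff, ← ha']
            exact Or.inr ha
          · rw [Function.Embedding.subtype_apply] at ha' hb
            rw [hb]
            rw [ha'] at ha
            refine (T.le_succ_iff_of_ne ?_).1 ha
            rintro rfl
            exact hp (hb ▸ b.2)
      exact this _ _ w (T.le_refl _)
    have h1 := T.fin_le_of_le (key ⟨τ.min' hne, τ.min'_mem hne⟩ (h.preconnected _ _))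
    exact hir (le_antisymm h1 (τ.min'_le _ hi))
  · rintro ⟨r, hr, hmin, h⟩
    have key : ∀ (m : ℕ) (x : Fin (n + 1)) (hx : x ∈ τ), (x : ℕ) = m →
        (T.graph.induce (τ : Set (Fin (n + 1)))).Reachable ⟨x, hx⟩ ⟨r, hr⟩ := by
      intro m
      induction m using Nat.strong_induction_on with
      | _ m ih =>
        intro x hx hm
        by_cases hxr : x = r
        · subst hxr
          exact SimpleGraph.Reachable.refl _
        rcases Fin.eq_zero_or_eq_succ x with rfl | ⟨i, rfl⟩
        · exact absurd (le_antisymm (Fin.zero_le _) (hmin _ hx)) hxr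
        · have hp := h i hx hxr
          have hlt := T.parent_lt i
          have hadj : (T.graph.induce (τ : Set (Fin (n + 1)))).Adj
              ⟨i.succ, hx⟩ ⟨T.parent i, hp⟩ := by
            simp only [SimpleGraph.comap_adj, graph, SimpleGraph.fromRel_adj]
            exact ⟨hlt.ne', Or.inr ⟨i, rfl, rfl⟩⟩
          exact hadj.reachable.trans (ih _ (by rw [← hm]; exact hlt) _ hp rfl)
    have : Nonempty (τ : Set (Fin (n + 1))) := ⟨⟨r, hr⟩⟩
    exact ⟨fun x y => (key _ x.1 x.2 rfl).trans (key _ y.1 y.2 rfl).symm⟩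

variable {T}

theorem IsTube.parent_mem {τ : Finset (Fin (n + 1))} (h : T.IsTube τ) {i : Fin n}
    {x : Fin (n + 1)} (hi : i.succ ∈ τ) (hx : x ∈ τ) (hlt : x < i.succ) : T.parent i ∈ τ := by
  obtain ⟨r, hr, hmin, hcl⟩ := T.isTube_iff.1 h
  exact hcl i hi ((hmin x hx).trans_lt hlt).ne'

theorem isTube_of_parent_mem {τ : Finset (Fin (n + 1))} {r : Fin (n + 1)} (hr : r ∈ τ)
    (hmin : ∀ x ∈ τ, r ≤ x)
    (h : ∀ i : Fin n, i.succ ∈ τ → i.succ ≠ r → T.parent i ∈ τ) : T.IsTube τ :=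
  T.isTube_iff.2 ⟨r, hr, hmin, h⟩

variable (T) in
/-- The edge joining `i + 1` to its parent lies in `τ`. -/
def HasEdge (τ : Finset (Fin (n + 1))) (i : Fin n) : Prop := i.succ ∈ τ ∧ T.parent i ∈ τ

theorem HasEdge.mono {σ τ : Finset (Fin (n + 1))} {i : Fin n} (h : T.HasEdge σ i) (hs : σ ⊆ τ) :
    T.HasEdge τ i := ⟨hs h.1, hs h.2⟩

theorem HasEdge.two_le_card {τ : Finset (Fin (n + 1))} {i : Fin n} (h : T.HasEdge τ i) :
    2 ≤ τ.card := Finset.one_lt_card.2 ⟨_, h.1, _, h.2, (T.parent_lt i).ne'⟩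

/-- A tube that meets both a set and its complement has an edge that crosses the boundary. -/
theorem IsTube.exists_crossing {τ : Finset (Fin (n + 1))} (h : T.IsTube τ)
    (S : Set (Fin (n + 1))) {x y : Fin (n + 1)} (hx : x ∈ τ) (hxS : x ∈ S) (hy : y ∈ τ)
    (hyS : y ∉ S) : ∃ i, T.HasEdge τ i ∧
      (i.succ ∈ S ∧ T.parent i ∉ S ∨ i.succ ∉ S ∧ T.parent i ∈ S) := by
  obtain ⟨r, hr, hmin, hcl⟩ := T.isTube_iff.1 h
  -- The case where the root lies in `S`: descend from `y` until `S` is entered. The other case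
  -- follows by passing to the complement.
  have key : ∀ (S : Set (Fin (n + 1))) (y : Fin (n + 1)), r ∈ S → y ∈ τ → y ∉ S →
      ∃ i, T.HasEdge τ i ∧ i.succ ∉ S ∧ T.parent i ∈ S := by
    intro S y hrS
    induction hm : (y : ℕ) using Nat.strong_induction_on generalizing y with
    | _ m ih =>
      intro hy hyS
      subst hm
      rcases Fin.eq_zero_or_eq_succ y with rfl | ⟨i, rfl⟩
      · exact absurd (le_antisymm (hmin _ hy) (Fin.zero_le _) ▸ hrS) hyS
      · have hp := hcl i hy (fun e => hyS (e ▸ hrS))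
        by_cases hpS : T.parent i ∈ S
        · exact ⟨i, ⟨hy, hp⟩, hyS, hpS⟩
        · exact ih _ (T.parent_lt i) _ rfl hp hpS
  by_cases hrS : r ∈ S
  · obtain ⟨i, hi, h1⟩ := key S y hrS hy hyS
    exact ⟨i, hi, Or.inr h1⟩
  · obtain ⟨i, hi, h1⟩ := key Sᶜ x hrS hx (fun h => h hxS)
    exact ⟨i, hi, Or.inl ⟨not_not.1 h1.1, h1.2⟩⟩

theorem IsTube.exists_edge {τ : Finset (Fin (n + 1))} (h : T.IsTube τ) (hc : 2 ≤ τ.card) :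
    ∃ i, T.HasEdge τ i := by
  obtain ⟨x, hx, y, hy, hxy⟩ := Finset.one_lt_card.1 hc
  obtain ⟨i, hi, -⟩ := h.exists_crossing {x} hx rfl hy (fun e => hxy e.symm)
  exact ⟨i, hi⟩

/-- The edge `i` is the only one joining the subtree above it to the rest, so a tube without this
edge cannot meet both sides. -/
theorem IsTube.le_all_or_not_le {τ : Finset (Fin (n + 1))} (h : T.IsTube τ) {i : Fin n}
    (hi : ¬ T.HasEdge τ i) : (∀ x ∈ τ, T.le i.succ x) ∨ ∀ x ∈ τ, ¬ T.le i.succ x := by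
  by_contra hc
  push Not at hc
  obtain ⟨⟨x, hx, hxS⟩, y, hy, hyS⟩ := hc
  obtain ⟨j, hj, h1⟩ := h.exists_crossing {x | T.le i.succ x} hy hyS hx hxS
  have hne : j ≠ i := fun e => hi (e ▸ hj)
  have := T.le_succ_iff_of_ne hne
  simp only [Set.mem_ofPred_eq] at h1
  tauto

open Classical in
/-- The part of `τ` above the edge `i`. -/
noncomputable def upper (T : PlaneTree n) (τ : Finset (Fin (n + 1))) (i : Fin n) :
    Finset (Fin (n + 1)) := τ.filter (T.le i.succ)

open Classical in
/-- The part of `τ` below the edge `i`. -/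
noncomputable def lower (T : PlaneTree n) (τ : Finset (Fin (n + 1))) (i : Fin n) :
    Finset (Fin (n + 1)) := τ.filter (¬ T.le i.succ ·)

theorem mem_upper {τ : Finset (Fin (n + 1))} {i : Fin n} {x : Fin (n + 1)} :
    x ∈ T.upper τ i ↔ x ∈ τ ∧ T.le i.succ x := by simp [upper]

theorem mem_lower {τ : Finset (Fin (n + 1))} {i : Fin n} {x : Fin (n + 1)} :
    x ∈ T.lower τ i ↔ x ∈ τ ∧ ¬ T.le i.succ x := by simp [lower]

theorem IsTube.upper {τ : Finset (Fin (n + 1))} (h : T.IsTube τ) {i : Fin n}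
    (hi : T.HasEdge τ i) : T.IsTube (T.upper τ i) := by
  refine isTube_of_parent_mem (r := i.succ) (mem_upper.2 ⟨hi.1, T.le_refl _⟩)
    (fun x hx => T.fin_le_of_le (mem_upper.1 hx).2) fun j hj hji => ?_
  rw [mem_upper] at hj ⊢
  have hne : j ≠ i := fun e => hji (e ▸ rfl)
  exact ⟨h.parent_mem hj.1 hi.2 ((T.parent_lt i).trans_le (T.fin_le_of_le hj.2)),
    (T.le_succ_iff_of_ne hne).1 hj.2⟩

theorem IsTube.lower {τ : Finset (Fin (n + 1))} (h : T.IsTube τ) {i : Fin n}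
    (hi : T.HasEdge τ i) : T.IsTube (T.lower τ i) := by
  obtain ⟨r, hr, hmin, hcl⟩ := T.isTube_iff.1 h
  refine isTube_of_parent_mem (r := r) (mem_lower.2 ⟨hr, fun hle => ?_⟩)
    (fun x hx => hmin x (mem_lower.1 hx).1) fun j hj hjr => ?_
  · exact absurd (T.fin_le_of_le hle) (not_le.2 ((hmin _ hi.2).trans_lt (T.parent_lt i)))
  · rw [mem_lower] at hj ⊢
    have hne : j ≠ i := fun e => hj.2 (e ▸ T.le_refl _)
    exact ⟨hcl j hj.1 hjr, fun hle => hj.2 ((T.le_succ_iff_of_ne hne).2 hle)⟩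

/-! ### Splitting edges of nestings -/

theorem IsNesting.subset_of_mem {N : Finset (Finset (Fin (n + 1)))} (hN : T.IsNesting N)
    {σ τ : Finset (Fin (n + 1))} (hσ : σ ∈ N) (hτ : τ ∈ N) {x y : Fin (n + 1)} (hxσ : x ∈ σ)
    (hxτ : x ∈ τ) (hyσ : y ∈ σ) (hyτ : y ∉ τ) : τ ⊆ σ := by
  rcases hN.nested_or_disjoint σ hσ τ hτ with h | h | h
  · exact absurd (h hyσ) hyτ
  · exact h
  · exact absurd hxτ (Finset.disjoint_left.1 h hxσ)

theorem IsNesting.insert {N : Finset (Finset (Fin (n + 1)))} (hN : T.IsNesting N)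
    {τ : Finset (Fin (n + 1))} (ht : T.IsTube τ) (hc : 2 ≤ τ.card)
    (h : ∀ σ ∈ N, σ ⊆ τ ∨ τ ⊆ σ ∨ Disjoint σ τ) : T.IsNesting (insert τ N) := by
  refine ⟨?_, Finset.mem_insert_of_mem hN.univ_mem, ?_, ?_⟩
  · intro σ hσ
    rcases Finset.mem_insert.1 hσ with rfl | hσ
    · exact ht
    · exact hN.isTube _ hσ
  · intro σ hσ
    rcases Finset.mem_insert.1 hσ with rfl | hσ
    · exact hc
    · exact hN.two_le_card _ hσ
  · intro σ hσ ρ hρ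
    rcases Finset.mem_insert.1 hσ with rfl | hσ'
    · rcases Finset.mem_insert.1 hρ with rfl | hρ'
      · exact Or.inl subset_rfl
      · rcases h ρ hρ' with h1 | h1 | h1
        · exact Or.inr (Or.inl h1)
        · exact Or.inl h1
        · exact Or.inr (Or.inr h1.symm)
    · rcases Finset.mem_insert.1 hρ with rfl | hρ'
      · exact h σ hσ'
      · exact hN.nested_or_disjoint σ hσ' ρ hρ'

theorem mem_of_maximal {N : Finset (Finset (Fin (n + 1)))} (hN : Maximal T.IsNesting N)
    {τ : Finset (Fin (n + 1))} (ht : T.IsTube τ) (hc : 2 ≤ τ.card)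
    (h : ∀ σ ∈ N, σ ⊆ τ ∨ τ ⊆ σ ∨ Disjoint σ τ) : τ ∈ N :=
  hN.le_of_ge (hN.prop.insert ht hc h) (Finset.subset_insert _ _) (Finset.mem_insert_self _ _)

open Classical in
/-- The smallest tube of the nesting `N` that contains the edge `i`. -/
noncomputable def split (T : PlaneTree n) (N : Finset (Finset (Fin (n + 1)))) (i : Fin n) :
    Finset (Fin (n + 1)) := (N.filter (T.HasEdge · i)).inf id

theorem split_subset {N : Finset (Finset (Fin (n + 1)))} {σ : Finset (Fin (n + 1))} {i : Fin n}
    (hσ : σ ∈ N) (hi : T.HasEdge σ i) : T.split N i ⊆ σ :=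
  by classical exact Finset.inf_le (f := id) (Finset.mem_filter.2 ⟨hσ, hi⟩)

theorem split_hasEdge (N : Finset (Finset (Fin (n + 1)))) (i : Fin n) :
    T.HasEdge (T.split N i) i := by
  classical
  -- An infimum over no tubes is the whole vertex set, so the claim makes sense for every collection
  -- `N`.
  have h : ∀ x, (∀ σ ∈ N, T.HasEdge σ i → x ∈ σ) → x ∈ T.split N i := by
    intro x hx
    rw [← Finset.singleton_subset_iff]
    refine Finset.le_inf fun σ hσ => ?_
    rw [Finset.mem_filter] at hσ
    exact Finset.singleton_subset_iff.2 (hx σ hσ.1 hσ.2)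
  exact ⟨h _ fun σ _ hi => hi.1, h _ fun σ _ hi => hi.2⟩

theorem IsNesting.split_mem {N : Finset (Finset (Fin (n + 1)))} (hN : T.IsNesting N)
    (i : Fin n) : T.split N i ∈ N := by
  classical
  obtain ⟨σ, hσ, hmin⟩ := (N.filter (T.HasEdge · i)).exists_min_image Finset.card
    ⟨Finset.univ, Finset.mem_filter.2 ⟨hN.univ_mem, Finset.mem_univ _, Finset.mem_univ _⟩⟩
  rw [Finset.mem_filter] at hσ
  have : T.split N i = σ := by
    refine (split_subset hσ.1 hσ.2).antisymm (Finset.le_inf fun τ hτ => ?_)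
    have hτ' := Finset.mem_filter.1 hτ
    rcases hN.nested_or_disjoint σ hσ.1 τ hτ'.1 with h | h | h
    · exact h
    · exact (Finset.eq_of_subset_of_card_le h (hmin τ hτ)).ge
    · exact absurd hτ'.2.1 (Finset.disjoint_left.1 h hσ.2.1)
  exact this ▸ hσ.1

theorem IsNesting.isTube_split {N : Finset (Finset (Fin (n + 1)))} (hN : T.IsNesting N)
    (i : Fin n) : T.IsTube (T.split N i) := hN.isTube _ (hN.split_mem i)

/-- A tube of a nesting that meets `split N i` either contains it, or lies on one side of the edge
`i`. -/
theorem IsNesting.split_subset_or {N : Finset (Finset (Fin (n + 1)))} (hN : T.IsNesting N)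
    {σ : Finset (Fin (n + 1))} (hσ : σ ∈ N) (i : Fin n) :
    T.split N i ⊆ σ ∨ Disjoint σ (T.split N i) ∨ σ ⊆ T.upper (T.split N i) i ∨
      σ ⊆ T.lower (T.split N i) i := by
  by_cases hi : T.HasEdge σ i
  · exact Or.inl (split_subset hσ hi)
  rcases hN.nested_or_disjoint σ hσ _ (hN.split_mem i) with h | h | h
  · rcases (hN.isTube σ hσ).le_all_or_not_le hi with h1 | h1
    · exact Or.inr (Or.inr (Or.inl fun x hx => mem_upper.2 ⟨h hx, h1 x hx⟩))
    · exact Or.inr (Or.inr (Or.inr fun x hx => mem_lower.2 ⟨h hx, h1 x hx⟩))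
  · exact Or.inl h
  · exact Or.inr (Or.inl h)

theorem upper_subset (τ : Finset (Fin (n + 1))) (i : Fin n) : T.upper τ i ⊆ τ :=
  fun _ hx => (mem_upper.1 hx).1

theorem lower_subset (τ : Finset (Fin (n + 1))) (i : Fin n) : T.lower τ i ⊆ τ :=
  fun _ hx => (mem_lower.1 hx).1

theorem disjoint_upper_lower (τ : Finset (Fin (n + 1))) (i : Fin n) :
    Disjoint (T.upper τ i) (T.lower τ i) :=
  Finset.disjoint_left.2 fun _ h h' => (mem_lower.1 h').2 (mem_upper.1 h).2

/-- By minimality of the split, every tube of `N` either contains it, misses it, or stays on one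
side of `i`. The upper half is thus compatible with all of `N`, and maximality puts it in `N`. -/
theorem upper_split_mem {N : Finset (Finset (Fin (n + 1)))} (hN : Maximal T.IsNesting N)
    {i : Fin n} (hc : 2 ≤ (T.upper (T.split N i) i).card) : T.upper (T.split N i) i ∈ N := by
  refine mem_of_maximal hN ((hN.prop.isTube_split i).upper (split_hasEdge N i)) hc fun σ hσ => ?_
  rcases hN.prop.split_subset_or hσ i with h | h | h | h
  · exact Or.inr (Or.inl ((upper_subset _ _).trans h))
  · exact Or.inr (Or.inr (h.mono_right (upper_subset _ _)))
  · exact Or.inl h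
  · exact Or.inr (Or.inr ((disjoint_upper_lower _ _).symm.mono_left h))

theorem lower_split_mem {N : Finset (Finset (Fin (n + 1)))} (hN : Maximal T.IsNesting N)
    {i : Fin n} (hc : 2 ≤ (T.lower (T.split N i) i).card) : T.lower (T.split N i) i ∈ N := by
  refine mem_of_maximal hN ((hN.prop.isTube_split i).lower (split_hasEdge N i)) hc fun σ hσ => ?_
  rcases hN.prop.split_subset_or hσ i with h | h | h | h
  · exact Or.inr (Or.inl ((lower_subset _ _).trans h))
  · exact Or.inr (Or.inr (h.mono_right (lower_subset _ _)))
  · exact Or.inr (Or.inr ((disjoint_upper_lower _ _).mono_left h))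
  · exact Or.inl h

/-- If two edges had the same split, cutting it at `j` would leave the edge `i` in one of the two
halves; that half is a tube of `N` strictly smaller than the split of `i`. -/
theorem split_injective {N : Finset (Finset (Fin (n + 1)))} (hN : Maximal T.IsNesting N) :
    Function.Injective (T.split N) := by
  intro i j hij
  by_contra hne
  have hi := split_hasEdge (T := T) N i
  have hj := split_hasEdge (T := T) N j
  by_cases h : T.le j.succ i.succ
  · have he : T.HasEdge (T.upper (T.split N j) j) i :=
      ⟨mem_upper.2 ⟨hij ▸ hi.1, h⟩, mem_upper.2 ⟨hij ▸ hi.2, (T.le_succ_iff_of_ne hne).1 h⟩⟩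
    have h1 := split_subset (upper_split_mem hN he.two_le_card) he
    exact T.not_le_parent j (mem_upper.1 (h1 (hij ▸ hj.2))).2
  · have he : T.HasEdge (T.lower (T.split N j) j) i :=
      ⟨mem_lower.2 ⟨hij ▸ hi.1, h⟩,
        mem_lower.2 ⟨hij ▸ hi.2, fun h' => h ((T.le_succ_iff_of_ne hne).2 h')⟩⟩
    have h1 := split_subset (lower_split_mem hN he.two_le_card) he
    exact (mem_lower.1 (h1 (hij ▸ hj.1))).2 (T.le_refl _)

/-- Suppose a larger nesting has an extra tube `τ`. Let `ρ` be the smallest tube of `N` around `τ`.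
Some edge `b` of `ρ` on the boundary of `τ` has split `ρ`, so by injectivity every edge of `τ` has
its split inside `τ`. A largest tube `ν` of `N` inside `τ` then contradicts itself: an edge of `τ`
on the boundary of `ν` has a split in `τ` strictly larger than `ν`. -/
theorem IsNesting.maximal {N : Finset (Finset (Fin (n + 1)))} (hN : T.IsNesting N)
    (hinj : Function.Injective (T.split N)) : Maximal T.IsNesting N := by
  classical
  refine ⟨hN, fun M hM hNM τ hτ => ?_⟩
  by_contra hτN
  have ht := hM.isTube τ hτ
  obtain ⟨ρ, hρ, hρmin⟩ := (N.filter (τ ⊆ ·)).exists_min_image Finset.card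
    ⟨Finset.univ, by simp [hN.univ_mem]⟩
  rw [Finset.mem_filter] at hρ
  have hρmin' : ∀ σ ∈ N, τ ⊆ σ → σ ⊆ ρ → σ = ρ := fun σ hσ h1 h2 =>
    Finset.eq_of_subset_of_card_le h2 (hρmin σ (Finset.mem_filter.2 ⟨hσ, h1⟩))
  obtain ⟨y, hyρ, hyτ⟩ : ∃ y ∈ ρ, y ∉ τ := by
    by_contra hc
    push Not at hc
    exact hτN (hρ.2.antisymm hc ▸ hρ.1)
  obtain ⟨e, he⟩ := ht.exists_edge (hM.two_le_card τ hτ)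
  -- an edge in `σ` that crosses the boundary of `ν`
  have cross : ∀ σ ν : Finset (Fin (n + 1)), T.IsTube σ → ∀ x y, x ∈ σ → x ∈ ν → y ∈ σ → y ∉ ν →
      ∃ i, T.HasEdge σ i ∧ ¬ T.HasEdge ν i ∧ (i.succ ∈ ν ∨ T.parent i ∈ ν) := by
    intro σ ν hσ x y h1 h2 h3 h4
    obtain ⟨i, hi, h⟩ := hσ.exists_crossing (ν : Set (Fin (n + 1))) h1 h2 h3 h4
    refine ⟨i, hi, ?_, ?_⟩ <;> simp only [HasEdge, Finset.mem_coe] at h ⊢ <;> tauto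
  have sub : ∀ ν ∈ M, ∀ i, ¬ T.HasEdge ν i → (i.succ ∈ ν ∨ T.parent i ∈ ν) →
      ν ⊆ T.split N i := by
    intro ν hν i h1 h2
    have h3 := split_hasEdge (T := T) N i
    have hm := hNM (hN.split_mem i)
    simp only [HasEdge] at h1 h3
    rcases h2 with h2 | h2
    · exact hM.subset_of_mem hm hν h3.1 h2 h3.2 (fun h => h1 ⟨h2, h⟩)
    · exact hM.subset_of_mem hm hν h3.2 h2 h3.1 (fun h => h1 ⟨h, h2⟩)
  obtain ⟨b, hbρ, hbτ, hb⟩ := cross ρ τ (hN.isTube ρ hρ.1) _ y (hρ.2 he.1) he.1 hyρ hyτ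
  have hbs : T.split N b = ρ :=
    hρmin' _ (hN.split_mem b) (sub τ hτ b hbτ hb) (split_subset hρ.1 hbρ)
  have hin : ∀ x, T.HasEdge τ x → T.split N x ⊆ τ := by
    intro x hx
    rcases hM.nested_or_disjoint _ (hNM (hN.split_mem x)) τ hτ with h | h | h
    · exact h
    · have := hinj ((hρmin' _ (hN.split_mem x) h
        (split_subset hρ.1 (hx.mono hρ.2))).trans hbs.symm)
      exact absurd (this ▸ hx) hbτ
    · exact absurd hx.1 (Finset.disjoint_left.1 h (split_hasEdge N x).1)
  obtain ⟨ν, hν, hνmax⟩ := (N.filter (· ⊆ τ)).exists_max_image Finset.card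
    ⟨T.split N e, Finset.mem_filter.2 ⟨hN.split_mem e, hin e he⟩⟩
  rw [Finset.mem_filter] at hν
  obtain ⟨z, hzτ, hzν⟩ : ∃ z ∈ τ, z ∉ ν := by
    by_contra hc
    push Not at hc
    exact hτN (hν.2.antisymm hc ▸ hν.1)
  obtain ⟨f, hf⟩ := (hN.isTube ν hν.1).exists_edge (hN.two_le_card ν hν.1)
  obtain ⟨g, hgτ, hgν, hg⟩ := cross τ ν ht _ z (hν.2 hf.1) hf.1 hzτ hzν
  have h1 := sub ν (hNM hν.1) g hgν hg
  have h2 := Finset.eq_of_subset_of_card_le h1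
    (hνmax _ (Finset.mem_filter.2 ⟨hN.split_mem g, hin g hgτ⟩))
  exact hgν (h2 ▸ split_hasEdge N g)

/-! ### Ornaments, and the monotonicity of inversions along moves. -/

namespace MaximalNesting

/-- A tube with root `i + 1` omits the parent of `i + 1`, hence is contained in the split of `i`;
the upper half of that split is itself a tube of `N` or a singleton. -/
theorem ornament_succ (N : T.MaximalNesting) (i : Fin n) :
    N.ornament i.succ = T.upper (T.split N.tubes i) i := by
  have hN := N.maximal.prop
  have hi := split_hasEdge (T := T) N.tubes i
  ext x
  simp only [ornament, Finset.mem_union, Finset.mem_singleton, Finset.mem_biUnion,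
    Finset.mem_filter, id]
  constructor
  · rintro (rfl | ⟨τ, ⟨hτ, hr⟩, hx⟩)
    · exact mem_upper.2 ⟨hi.1, T.le_refl _⟩
    · exact mem_upper.2 ⟨hN.subset_of_mem (hN.split_mem i) hτ hi.1 hr.1 hi.2
        (fun h => T.not_le_parent i (hr.2 _ h)) hx, hr.2 x hx⟩
  · intro hx
    by_cases hxi : x = i.succ
    · exact Or.inl hxi
    · have hi' := mem_upper.2 ⟨hi.1, T.le_refl i.succ⟩
      exact Or.inr ⟨_, ⟨upper_split_mem N.maximal (Finset.one_lt_card.2 ⟨x, hx, _, hi', hxi⟩),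
        hi', fun u hu => (mem_upper.1 hu).2⟩, hx⟩

/-- `i < j` and the smallest tube containing the edge `i` contains the vertex `j + 1`. -/
def Inv (N : T.MaximalNesting) (i j : Fin n) : Prop := i < j ∧ j.succ ∈ T.split N.tubes i

/-- An inversion `(i, j)` can be lost only if the split of `i` in `N'` is the new tube `τ'`;
otherwise that split is an old tube around `i` and contains the old split. The two cases depend on
whether `i` is an edge of the removed tube `τ`. -/
theorem Move.inv {N N' : T.MaximalNesting} (h : Move N N') {i j : Fin n} (hij : N.Inv i j) :
    N'.Inv i j := by
  obtain ⟨τ, τ', hτ, hτN', hτ', hτ'N, he, hlt⟩ := h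
  have hN := N.maximal.prop
  have hN' := N'.maximal.prop
  have hK : ∀ σ ∈ N.tubes, σ ≠ τ → σ ∈ N'.tubes := fun σ hσ h =>
    Finset.mem_of_mem_erase (he ▸ Finset.mem_erase.2 ⟨h, hσ⟩)
  have hK' : ∀ σ ∈ N'.tubes, σ ≠ τ' → σ ∈ N.tubes := fun σ hσ h =>
    Finset.mem_of_mem_erase (he.symm ▸ Finset.mem_erase.2 ⟨h, hσ⟩)
  -- the two tubes overlap properly
  have hcomp : ¬ (τ ⊆ τ' ∨ τ' ⊆ τ ∨ Disjoint τ τ') := by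
    intro h
    refine hτ'N (mem_of_maximal N.maximal (hN'.isTube _ hτ') (hN'.two_le_card _ hτ')
      fun σ hσ => ?_)
    by_cases hσ' : σ = τ
    · exact hσ' ▸ h
    · exact hN'.nested_or_disjoint σ (hK σ hσ hσ') τ' hτ'
  push Not at hcomp
  obtain ⟨-, h2, h3⟩ := hcomp
  obtain ⟨c, hc', hc⟩ := Finset.not_subset.1 h2
  obtain ⟨b, hb, hb'⟩ := Finset.not_disjoint_iff.1 h3
  refine ⟨hij.1, ?_⟩
  by_contra hj
  have hS := split_hasEdge (T := T) N.tubes i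
  have hS' := split_hasEdge (T := T) N'.tubes i
  have hS'eq : T.split N'.tubes i = τ' := by
    by_contra hne
    exact hj (split_subset (hK' _ (hN'.split_mem i) hne) hS' hij.2)
  rw [hS'eq] at hj hS'
  -- An edge `e` of `τ'` on the boundary of `τ` has a split in `N'` other than `τ'`, hence an old
  -- tube, which contains `τ`. It also lies inside `τ'`, so `j + 1` would be in `τ'`.
  by_cases hiτ : T.HasEdge τ i
  · have hjτ := split_subset hτ hiτ hij.2
    obtain ⟨e, he1, he2⟩ := (hN'.isTube _ hτ').exists_crossing (τ : Set (Fin (n + 1))) hb' hb hc' hc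
    simp only [Finset.mem_coe] at he2
    have hne : e ≠ i := by
      rintro rfl
      rcases he2 with h | h
      exacts [h.2 hiτ.2, h.1 hiτ.1]
    have hse := split_hasEdge (T := T) N'.tubes e
    have hm : T.split N'.tubes e ∈ N.tubes := hK' _ (hN'.split_mem e)
      (fun h => hne (split_injective N'.maximal (h.trans hS'eq.symm)))
    have hsub : τ ⊆ T.split N'.tubes e := by
      rcases he2 with h | h
      · exact hN.subset_of_mem hm hτ hse.1 h.1 hse.2 h.2
      · exact hN.subset_of_mem hm hτ hse.2 h.2 hse.1 h.1
    exact hj (split_subset hτ' he1 (hsub hjτ))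
  -- An endpoint of `i` lies in `τ' \ τ`, so the direction of the move bounds `τ \ τ'` by `i + 1`
  -- and excludes `j + 1` from `τ`. An edge `e` of `π` leaving `τ ∪ τ'` then has a split containing
  -- `τ'`, hence the edge `i`, and so equal to `π`: this contradicts injectivity.
  · have hall : ∀ x ∈ τ, x ∉ τ' → x ≤ i.succ := by
      intro x hx hx'
      by_cases h : i.succ ∈ τ
      · have h' : T.parent i ∉ τ := fun h' => hiτ ⟨h, h'⟩
        exact (hlt x (Finset.mem_sdiff.2 ⟨hx, hx'⟩) _
          (Finset.mem_sdiff.2 ⟨hS'.2, h'⟩)).le.trans (T.parent_lt i).le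
      · exact (hlt x (Finset.mem_sdiff.2 ⟨hx, hx'⟩) _ (Finset.mem_sdiff.2 ⟨hS'.1, h⟩)).le
    have hjτ : j.succ ∉ τ := fun h =>
      absurd (hall _ h hj) (not_le.2 (Fin.succ_lt_succ_iff.2 hij.1))
    set π := T.split N.tubes i with hπ
    have hπτ : π ≠ τ := fun h => hiτ (h ▸ hS)
    have hπN := hN.split_mem i
    have hπN' := hK π hπN hπτ
    have hτ'π : τ' ⊆ π := hS'eq ▸ split_subset hπN' hS
    have hnot : ¬ (i.succ ∈ τ ∧ T.parent i ∈ τ) := hiτ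
    have hτπ : τ ⊆ π := by
      by_cases h : i.succ ∈ τ
      · exact hN.subset_of_mem hπN hτ hS.1 h hS.2 (fun h' => hnot ⟨h, h'⟩)
      · exact hN.subset_of_mem hπN hτ (hτ'π hb') hb hS.1 h
    obtain ⟨e, he1, he2⟩ := (hN.isTube _ hπN).exists_crossing (↑(τ ∪ τ') : Set (Fin (n + 1)))
      (hτπ hb) (by simp [hb]) hij.2 (by simp [hj, hjτ])
    simp only [Finset.mem_coe, Finset.mem_union] at he2
    have hne : e ≠ i := by
      rintro rfl
      rcases he2 with h | h
      exacts [h.2 (Or.inr hS'.2), h.1 (Or.inr hS'.1)]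
    have hse := split_hasEdge (T := T) N.tubes e
    have hm := hN.split_mem e
    have hm' : T.split N.tubes e ∈ N'.tubes := hK _ hm (by
      intro h
      rw [h] at hse
      rcases he2 with h | h
      exacts [h.2 (Or.inl hse.2), h.1 (Or.inl hse.1)])
    obtain ⟨p, q, hp, hq, hpU, hqτ, hqτ'⟩ : ∃ p q, p ∈ T.split N.tubes e ∧ q ∈ T.split N.tubes e ∧
        (p ∈ τ ∨ p ∈ τ') ∧ q ∉ τ ∧ q ∉ τ' := by
      rcases he2 with h | h
      · exact ⟨_, _, hse.1, hse.2, h.1, by tauto, by tauto⟩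
      · exact ⟨_, _, hse.2, hse.1, h.2, by tauto, by tauto⟩
    have hτ'sub : τ' ⊆ T.split N.tubes e := by
      rcases hpU with h | h
      · have := hN.subset_of_mem hm hτ hp h hq hqτ
        exact hN'.subset_of_mem hm' hτ' (this hb) hb' hq hqτ'
      · exact hN'.subset_of_mem hm' hτ' hp h hq hqτ'
    have hsub : π ⊆ T.split N.tubes e := split_subset hm (hS'.mono hτ'sub)
    exact hne (split_injective N.maximal ((split_subset hπN he1).antisymm hsub))

end MaximalNesting

end PlaneTree

/-! ### Closure properties of inversions, and the order of the edges. -/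

namespace PlaneTree

variable {n k : ℕ} {T : PlaneTree n}

theorem IsTube.mem_of_le {τ : Finset (Fin (n + 1))} (h : T.IsTube τ) {a m b : Fin (n + 1)}
    (hm : m ∈ τ) (hma : m ≤ a) (hb : b ∈ τ) (hab : T.le a b) : a ∈ τ := by
  induction hab with
  | refl => exact hb
  | tail hac hcb ih =>
    obtain ⟨j, rfl, rfl⟩ := hcb
    exact ih (h.parent_mem hb hm ((hma.trans (T.fin_le_of_le hac)).trans_lt (T.parent_lt j)))

namespace MaximalNesting

theorem Inv.hasEdge {N : T.MaximalNesting} {a b : Fin n} (h : N.Inv a b) :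
    T.HasEdge (T.split N.tubes a) b :=
  ⟨h.2, (N.maximal.prop.isTube_split a).parent_mem h.2 (split_hasEdge _ a).2
    ((T.parent_lt a).trans (Fin.succ_lt_succ_iff.2 h.1))⟩

theorem Inv.split_subset {N : T.MaximalNesting} {a b : Fin n} (h : N.Inv a b) :
    T.split N.tubes b ⊆ T.split N.tubes a :=
  PlaneTree.split_subset (N.maximal.prop.split_mem a) h.hasEdge

theorem Inv.trans {N : T.MaximalNesting} {a b c : Fin n} (h : N.Inv a b) (h' : N.Inv b c) :
    N.Inv a c := ⟨h.1.trans h'.1, h.split_subset h'.2⟩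

theorem Inv.of_le {N : T.MaximalNesting} {a b c : Fin n} (h : N.Inv a c) (hab : a < b)
    (hbc : T.le b.succ c.succ) : N.Inv a b :=
  ⟨hab, (N.maximal.prop.isTube_split a).mem_of_le (split_hasEdge _ a).1
    (Fin.succ_le_succ_iff.2 hab.le) h.2 hbc⟩

/-- The edge `a` comes before the edge `b` in the total order on edges whose inversions are given by
`Inv`. -/
def Before (N : T.MaximalNesting) (a b : Fin n) : Prop := N.Inv a b ∨ b < a ∧ ¬ N.Inv b a

theorem before_of_split_subset (N : T.MaximalNesting) {a c : Fin n} (hne : c ≠ a)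
    (h : T.split N.tubes c ⊆ T.split N.tubes a) : N.Before a c := by
  rcases lt_or_gt_of_ne hne with hlt | hlt
  · refine Or.inr ⟨hlt, fun hi => ?_⟩
    exact hne (split_injective N.maximal (h.antisymm hi.split_subset))
  · exact Or.inl ⟨hlt, h (split_hasEdge _ c).1⟩

instance : Finite T.MaximalNesting :=
  Finite.of_injective MaximalNesting.tubes fun _ _ h => MaximalNesting.ext h

end MaximalNesting

/-! ### Brooms -/

theorem broom_parent (i : Fin n) : ((broom k n).parent i : ℕ) = min (i : ℕ) (n - k) := rfl

theorem broom_le_iff {a b : Fin (n + 1)} :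
    (broom k n).le a b ↔ a = b ∨ a < b ∧ (a : ℕ) ≤ n - k := by
  induction hb : (b : ℕ) using Nat.strong_induction_on generalizing b with
  | _ m ih =>
    subst hb
    rcases Fin.eq_zero_or_eq_succ b with rfl | ⟨j, rfl⟩
    · refine ⟨fun h => Or.inl (le_antisymm ((broom k n).fin_le_of_le h) (Fin.zero_le _)), ?_⟩
      rintro (rfl | h)
      · exact le_refl _ _
      · exact absurd h.1 (Fin.not_lt_zero a)
    · have hp := broom_parent (k := k) j
      rw [le_succ_iff, ih _ ((broom k n).parent_lt j) rfl]
      simp only [Fin.ext_iff, Fin.lt_def, Fin.val_succ, hp]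
      omega

theorem broom_le_succ {b c : Fin n} (hbc : b ≤ c) (hb : (b : ℕ) < n - k) :
    (broom k n).le b.succ c.succ := by
  rw [broom_le_iff]
  simp only [Fin.ext_iff, Fin.lt_def, Fin.le_def, Fin.val_succ] at *
  omega

namespace MaximalNesting

section Broom

variable (N : (broom k n).MaximalNesting)

theorem broom_inv_of_inv {a b c : Fin n} (h : N.Inv a c) (hab : a < b) (hbc : b < c)
    (hb : (b : ℕ) < n - k) : N.Inv a b := h.of_le hab (broom_le_succ hbc.le hb)

/-- If `b` is a leaf edge, then `b` and `c` share their parent, which lies in `split a` and in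
`split b`. If `split a` misses `b + 1`, it is therefore contained in `split b`, and `c + 1` comes
along. -/
theorem broom_inv_or_inv {a b c : Fin n} (h : N.Inv a c) (hab : a < b) (hbc : b < c) :
    N.Inv a b ∨ N.Inv b c := by
  by_cases hb : (b : ℕ) < n - k
  · exact Or.inl (N.broom_inv_of_inv h hab hbc hb)
  by_contra hc
  push Not at hc
  have hN := N.maximal.prop
  have hpc : (broom k n).parent c = (broom k n).parent b := by
    ext
    have := Fin.lt_def.1 hbc
    simp only [broom_parent]
    omega
  have hmem := h.hasEdge.2
  rw [hpc] at hmem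
  refine hc.2 ⟨hbc, ?_⟩
  exact hN.subset_of_mem (hN.split_mem b) (hN.split_mem a) (split_hasEdge _ b).2 hmem
    (split_hasEdge _ b).1 (fun h' => hc.1 ⟨hab, h'⟩) h.2

theorem before_trans {a b c : Fin n} (h : N.Before a b) (h' : N.Before b c) : N.Before a c := by
  have t := fun {x y z : Fin n} (h : N.Inv x y) (h' : N.Inv y z) => h.trans h'
  have s := fun {x y z : Fin n} => N.broom_inv_or_inv (a := x) (b := y) (c := z)
  have l := fun {x y : Fin n} (h : N.Inv x y) => h.1
  unfold Before at *
  rcases h with h | ⟨h1, h2⟩ <;> rcases h' with h' | ⟨h1', h2'⟩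
  · exact Or.inl (t h h')
  · rcases lt_trichotomy a c with hl | rfl | hl
    · exact Or.inl ((s h hl h1').resolve_right h2')
    · exact absurd h h2'
    · exact Or.inr ⟨hl, fun hc => h2' (t hc h)⟩
  · rcases lt_trichotomy a c with hl | rfl | hl
    · exact Or.inl ((s h' h1 hl).resolve_left h2)
    · exact absurd h' h2
    · exact Or.inr ⟨hl, fun hc => h2 (t h' hc)⟩
  · exact Or.inr ⟨h1'.trans h1, fun hc => (s hc h1' h1).elim h2' h2⟩

theorem not_before_self {T : PlaneTree n} (N : T.MaximalNesting) (a : Fin n) :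
    ¬ N.Before a a := by
  rintro (h | h)
  · exact lt_irrefl _ h.1
  · exact lt_irrefl _ h.1

theorem before_total {T : PlaneTree n} (N : T.MaximalNesting) {a b : Fin n} (h : a ≠ b) :
    N.Before a b ∨ N.Before b a := by
  unfold Before
  rcases lt_or_gt_of_ne h with h | h <;> tauto

end Broom

end MaximalNesting

end PlaneTree

/-! ### Permutations from total orders, and adjacent inversions. -/

theorem exists_perm_lt_iff {n : ℕ} (r : Fin n → Fin n → Prop) (hirr : ∀ a, ¬ r a a)
    (htr : ∀ a b c, r a b → r b c → r a c) (htot : ∀ a b, a ≠ b → r a b ∨ r b a) :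
    ∃ π : Equiv.Perm (Fin n), ∀ a b, π a < π b ↔ r a b := by
  classical
  have hlt : ∀ a, (Finset.univ.filter (r · a)).card < n := fun a =>
    (Finset.card_lt_card (Finset.filter_ssubset (p := (r · a)).2 ⟨a, Finset.mem_univ _, hirr a⟩)).trans_eq
      (Finset.card_fin n)
  let f : Fin n → Fin n := fun a => ⟨(Finset.univ.filter (r · a)).card, hlt a⟩
  have hf : ∀ a b, r a b → f a < f b := by
    intro a b hab
    change (Finset.univ.filter (r · a)).card < (Finset.univ.filter (r · b)).card
    refine Finset.card_lt_card (Finset.ssubset_iff_of_subset ?_ |>.2 ⟨a, ?_, ?_⟩)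
    · intro c hc
      simp only [Finset.mem_filter, Finset.mem_univ, true_and] at hc ⊢
      exact htr c a b hc hab
    · simpa using hab
    · simpa using hirr a
  have hinj : Function.Injective f := by
    intro a b hab
    by_contra hne
    rcases htot a b hne with h | h
    · exact (hf _ _ h).ne hab
    · exact (hf _ _ h).ne hab.symm
  refine ⟨Equiv.ofBijective f (Finite.injective_iff_bijective.1 hinj), fun a b => ⟨fun h => ?_,
    fun h => hf a b h⟩⟩
  change f a < f b at h
  have hne : a ≠ b := fun e => h.ne (e ▸ rfl)
  exact (htot a b hne).resolve_right fun h' => lt_asymm h (hf _ _ h')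

namespace Weak

variable {n : ℕ}

/-- The inversions of `w` in terms of edges: the label `j` corresponds to the edge `j.rev`. -/
def EdgeInv (w : Weak n) (a b : Fin n) : Prop :=
  a < b ∧ w.perm.symm a.rev < w.perm.symm b.rev

theorem le_iff_edgeInv {u v : Weak n} : u ≤ v ↔ ∀ a b, u.EdgeInv a b → v.EdgeInv a b := by
  constructor
  · intro h a b hab
    have h1 : (b.rev, a.rev) ∈ u.inversions := ⟨Fin.rev_lt_rev.2 hab.1, hab.2⟩
    have h2 : (b.rev, a.rev) ∈ v.inversions := h h1
    exact ⟨hab.1, h2.2⟩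
  · rintro h ⟨i, j⟩ hij
    have h1 := h j.rev i.rev ⟨Fin.rev_lt_rev.2 hij.1, by simpa using hij.2⟩
    exact ⟨hij.1, by simpa using h1.2⟩

/-- If the inversions of `P` are among those of `Q`, then some inversion of `Q` that is not one of
`P` is formed by letters that are adjacent in `Q`. -/
theorem exists_adjacent_inversion {P Q : Fin n → Fin n} (hP : Function.Injective P)
    (h : ∀ a b, a < b → P a < P b → Q a < Q b) {a b : Fin n}
    (hab : a < b) (hQab : Q a < Q b) (hPab : ¬ P a < P b) :
    ∃ a b, a < b ∧ Q a < Q b ∧ ¬ P a < P b ∧ ∀ c, ¬ (Q a < Q c ∧ Q c < Q b) := by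
  induction hm : (Q b : ℕ) - Q a using Nat.strong_induction_on generalizing a b with
  | _ m ih =>
    subst hm
    by_cases hc : ∃ c, Q a < Q c ∧ Q c < Q b
    · obtain ⟨c, h1, h2⟩ := hc
      have hPa : P b < P a := lt_of_le_of_ne (not_lt.1 hPab) fun e => hab.ne' (hP e)
      have hca : c ≠ a := fun e => h1.ne' (congrArg Q e)
      have hcb : c ≠ b := fun e => h2.ne (congrArg Q e)
      -- When some `c` sits between `a` and `b`, one of the pairs `(a, c)`, `(c, b)` is again an
      -- inversion of `Q` and not of `P`, with a smaller gap.
      have key1 : a < c → ¬ P a < P c → ∃ a b, a < b ∧ Q a < Q b ∧ ¬ P a < P b ∧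
          ∀ c, ¬ (Q a < Q c ∧ Q c < Q b) := fun h3 h4 =>
        ih _ (by have := Fin.lt_def.1 h1; have := Fin.lt_def.1 h2; omega) h3 h1 h4 rfl
      have key2 : c < b → ¬ P c < P b → ∃ a b, a < b ∧ Q a < Q b ∧ ¬ P a < P b ∧
          ∀ c, ¬ (Q a < Q c ∧ Q c < Q b) := fun h3 h4 =>
        ih _ (by have := Fin.lt_def.1 h1; have := Fin.lt_def.1 h2; omega) h3 h2 h4 rfl
      rcases lt_or_gt_of_ne hca with h3 | h3
      · refine key2 (h3.trans hab) fun h4 => ?_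
        exact lt_asymm h1 (h c a h3 (h4.trans hPa))
      · by_cases h4 : P a < P c
        · rcases lt_or_gt_of_ne hcb with h5 | h5
          · exact key2 h5 fun h6 => lt_asymm (hPa.trans h4) h6
          · exact absurd (h b c h5 (hPa.trans h4)) (lt_asymm h2)
        · exact key1 h3 h4
    · push Not at hc
      exact ⟨a, b, hab, hQab, hPab, fun c hc' => absurd hc'.2 (not_lt.2 (hc c hc'.1))⟩

end Weak

namespace PlaneTree.MaximalNesting

variable {n k : ℕ}

theorem exists_weak (N : (broom k n).MaximalNesting) :
    ∃ w : Weak n, ∀ a b : Fin n, w.perm.symm a.rev < w.perm.symm b.rev ↔ N.Before a b := by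
  obtain ⟨π, hπ⟩ := exists_perm_lt_iff N.Before N.not_before_self
    (fun _ _ _ => N.before_trans) (fun _ _ => N.before_total)
  refine ⟨(Fin.revPerm.trans π).symm, fun a b => ?_⟩
  rw [← hπ]
  change π a.rev.rev < π b.rev.rev ↔ _
  simp

/-- The permutation whose inversions are the pairs in `N.Inv`. -/
noncomputable def toWeak (N : (broom k n).MaximalNesting) : Weak n := N.exists_weak.choose

theorem toWeak_lt_iff (N : (broom k n).MaximalNesting) {a b : Fin n} :
    N.toWeak.perm.symm a.rev < N.toWeak.perm.symm b.rev ↔ N.Before a b :=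
  N.exists_weak.choose_spec a b

theorem edgeInv_toWeak (N : (broom k n).MaximalNesting) {a b : Fin n} :
    N.toWeak.EdgeInv a b ↔ N.Inv a b := by
  rw [Weak.EdgeInv, toWeak_lt_iff, Before]
  constructor
  · rintro ⟨h, h' | h'⟩
    · exact h'
    · exact absurd h h'.1.asymm
  · exact fun h => ⟨h.1, Or.inl h⟩

end PlaneTree.MaximalNesting

/-! ### Undoing an adjacent inversion by a move. -/

namespace PlaneTree.MaximalNesting

variable {n k : ℕ}

/-- If the edges `a < b` form an inversion and `split b` is covered by `split a`, then exchanging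
`split b` for the part of `split a` below `b` is a downward move. -/
theorem exists_move (N : (broom k n).MaximalNesting) {a b : Fin n} (hab : N.Inv a b)
    (hadj : ∀ c, ¬ (N.Before a c ∧ N.Before c b)) :
    ∃ M : (broom k n).MaximalNesting, Move M N ∧
      (∀ σ, σ ∈ M.tubes ↔ σ = (broom k n).lower ((broom k n).split N.tubes a) b ∨
        σ ≠ (broom k n).split N.tubes b ∧ σ ∈ N.tubes) ∧
      (∀ i : Fin n, a < i → i.succ ∈ (broom k n).split N.tubes a →
        i.succ ∈ (broom k n).split N.tubes b) ∧
      (∀ c, c ≠ a → (broom k n).HasEdge ((broom k n).split N.tubes a) c → ∀ x,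
        x ∈ (broom k n).split N.tubes c → x ∈ (broom k n).split N.tubes b →
        (broom k n).split N.tubes c ⊆ (broom k n).split N.tubes b) := by
  classical
  have hN := N.maximal.prop
  have hinj := split_injective N.maximal
  have hea := split_hasEdge (T := broom k n) N.tubes a
  have heb := split_hasEdge (T := broom k n) N.tubes b
  have hπN := hN.split_mem a
  have hρN := hN.split_mem b
  set π := (broom k n).split N.tubes a with hπ
  set ρ := (broom k n).split N.tubes b with hρ
  have hlt : a < b := hab.1
  have hρπ : ρ ⊆ π := hab.split_subset
  have hρπ' : ρ ≠ π := fun h => hlt.ne' (hinj h)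
  have hbπ : (broom k n).HasEdge π b := hab.hasEdge
  -- `split b` is covered by `split a`
  have hcov : ∀ σ ∈ N.tubes, ρ ⊆ σ → σ ⊆ π → σ = ρ ∨ σ = π := by
    intro σ hσ h1 h2
    by_contra hc
    push Not at hc
    obtain ⟨y, hy, hyρ⟩ := Finset.exists_of_ssubset (h1.ssubset_of_ne hc.1.symm)
    obtain ⟨c, hc1, hc2⟩ := (hN.isTube σ hσ).exists_crossing (ρ : Set (Fin (n + 1)))
      (h1 heb.1) heb.1 hy hyρ
    simp only [Finset.mem_coe] at hc2
    have hec := split_hasEdge (T := broom k n) N.tubes c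
    have hcN := hN.split_mem c
    have h3 : ρ ⊆ (broom k n).split N.tubes c := by
      rcases hc2 with h | h
      · exact hN.subset_of_mem hcN hρN hec.1 h.1 hec.2 h.2
      · exact hN.subset_of_mem hcN hρN hec.2 h.2 hec.1 h.1
    have h4 : (broom k n).split N.tubes c ⊆ σ := split_subset hσ hc1
    have hcb : c ≠ b := by
      rintro rfl
      rcases hc2 with h | h
      exacts [h.2 heb.2, h.1 heb.1]
    have hca : c ≠ a := by
      rintro rfl
      exact hc.2 (h2.antisymm h4)
    exact hadj c ⟨N.before_of_split_subset hca (h4.trans h2), N.before_of_split_subset hcb.symm h3⟩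
  -- By the covering property, a split properly containing `ρ` and contained in `π` is `π` itself,
  -- which belongs to `a` alone.
  have hmeet : ∀ c, c ≠ a → (broom k n).HasEdge π c → ∀ x, x ∈ (broom k n).split N.tubes c → x ∈ ρ →
      (broom k n).split N.tubes c ⊆ ρ := by
    intro c hca hc x hx hx'
    rcases hN.nested_or_disjoint _ (hN.split_mem c) ρ hρN with h | h | h
    · exact h
    · rcases hcov _ (hN.split_mem c) h (split_subset hπN hc) with h1 | h1
      · exact h1.le
      · exact absurd (hinj h1) hca
    · exact absurd hx' (Finset.disjoint_left.1 h hx)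
  have hpar : ∀ i : Fin n, a < i → i.succ ∈ π → (broom k n).HasEdge π i := fun i hi h =>
    ⟨h, (hN.isTube π hπN).parent_mem h hea.2
      (((broom k n).parent_lt a).trans (Fin.succ_lt_succ_iff.2 hi))⟩
  have habove : ∀ i : Fin n, a < i → i.succ ∈ π → i.succ ∈ ρ := by
    intro i
    induction hm : (i : ℕ) using Nat.strong_induction_on generalizing i with
    | _ m ih =>
      intro hai hi
      subst hm
      have hei := hpar i hai hi
      have hgoal : (broom k n).parent i ∈ ρ → i.succ ∈ ρ := fun h =>
        hmeet i hai.ne' hei _ (split_hasEdge _ i).2 h (split_hasEdge _ i).1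
      apply hgoal
      have hpi := broom_parent (k := k) i
      have hpb := broom_parent (k := k) b
      have hal := Fin.lt_def.1 hai
      have hbl := Fin.lt_def.1 hlt
      -- It remains to put the parent of `i` in `ρ`. For a chain edge `a` this is either the
      -- induction hypothesis or the vertex `a + 1`; the latter lies in `ρ`, since otherwise the
      -- root of `ρ` is some `c + 1 > a + 1` and the split of `c` drags the parent of `c + 1` into
      -- `ρ`. For a leaf edge `a`, the edges `i` and `b` have the same parent.
      by_cases hak : (a : ℕ) < n - k
      · by_cases hpa : (broom k n).parent i = a.succ
        · rw [hpa]
          by_contra hc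
          obtain ⟨r, hr, hmin, hcl⟩ := (broom k n).isTube_iff.1 (hN.isTube ρ hρN)
          rcases le_or_gt r a.succ with h | h
          · exact hc ((hN.isTube ρ hρN).mem_of_le hr h heb.1 (broom_le_succ hlt.le hak))
          · rcases Fin.eq_zero_or_eq_succ r with rfl | ⟨c, rfl⟩
            · exact absurd h (Fin.not_lt_zero _)
            · have hac := Fin.succ_lt_succ_iff.1 h
              have := hmeet c hac.ne' (hpar c hac (hρπ hr)) _ (split_hasEdge _ c).1 hr
                (split_hasEdge _ c).2
              exact absurd (hmin _ this) (not_le.2 ((broom k n).parent_lt c))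
        · obtain ⟨j, hj⟩ : ∃ j : Fin n, (broom k n).parent i = j.succ := by
            rcases Fin.eq_zero_or_eq_succ ((broom k n).parent i) with h | h
            · rw [h] at hpi
              simp only [Fin.val_zero] at hpi
              omega
            · exact h
          have hjv : (j : ℕ) + 1 = min (i : ℕ) (n - k) := by
            rw [hj] at hpi
            simpa using hpi
          have hja : (j : ℕ) ≠ a := fun h => hpa (by rw [hj, Fin.ext h])
          rw [hj]
          exact ih j (by omega) j rfl (Fin.lt_def.2 (by omega)) (hj ▸ hei.2)
      · have : (broom k n).parent i = (broom k n).parent b := Fin.ext (by rw [hpi, hpb]; omega)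
        exact this ▸ heb.2
  set τ := (broom k n).lower π b with hτ
  have hτπ : τ ⊆ π := lower_subset _ _
  have hnle : ∀ {x : Fin (n + 1)}, x ≤ a.succ → ¬ (broom k n).le b.succ x := fun hx h =>
    absurd (((broom k n).fin_le_of_le h).trans hx) (not_le.2 (Fin.succ_lt_succ_iff.2 hlt))
  have hτa : (broom k n).HasEdge τ a := ⟨mem_lower.2 ⟨hea.1, hnle le_rfl⟩,
    mem_lower.2 ⟨hea.2, hnle ((broom k n).parent_lt a).le⟩⟩
  have hbτ : b.succ ∉ τ := fun h => (mem_lower.1 h).2 ((broom k n).le_refl _)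
  have hτN : τ ∉ N.tubes := fun h => hbτ (split_subset h hτa hbπ.1)
  have hτρ : τ ≠ ρ := fun h => hbτ (h ▸ heb.1)
  have huniv : Finset.univ ≠ ρ := fun h =>
    hρπ' (hρπ.antisymm (h ▸ Finset.subset_univ π))
  have hmem : ∀ σ, σ ∈ insert τ (N.tubes.erase ρ) ↔ σ = τ ∨ σ ≠ ρ ∧ σ ∈ N.tubes := by
    intro σ
    rw [Finset.mem_insert, Finset.mem_erase]
  have hnest : (broom k n).IsNesting (insert τ (N.tubes.erase ρ)) := by
    have hE : (broom k n).IsNesting (N.tubes.erase ρ) :=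
      ⟨fun σ h => hN.isTube σ (Finset.mem_of_mem_erase h),
        Finset.mem_erase.2 ⟨huniv, hN.univ_mem⟩,
        fun σ h => hN.two_le_card σ (Finset.mem_of_mem_erase h),
        fun σ h σ' h' => hN.nested_or_disjoint σ (Finset.mem_of_mem_erase h) σ'
          (Finset.mem_of_mem_erase h')⟩
    refine hE.insert ((hN.isTube π hπN).lower hbπ) hτa.two_le_card fun σ hσ => ?_
    rw [Finset.mem_erase] at hσ
    rcases hN.nested_or_disjoint σ hσ.2 π hπN with h | h | h
    · rcases hN.nested_or_disjoint σ hσ.2 ρ hρN with h1 | h1 | h1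
      · rcases hN.split_subset_or hσ.2 b with h2 | h2 | h2 | h2
        · exact absurd (h1.antisymm h2) hσ.1
        · exact Or.inl fun x hx => absurd (h1 hx) (Finset.disjoint_left.1 h2 hx)
        · exact Or.inr (Or.inr (Finset.disjoint_left.2 fun x hx hx' =>
            (mem_lower.1 hx').2 (mem_upper.1 (h2 hx)).2))
        · exact Or.inl fun x hx => mem_lower.2 ⟨h hx, (mem_lower.1 (h2 hx)).2⟩
      · rcases hcov σ hσ.2 h1 h with rfl | rfl
        · exact absurd rfl hσ.1
        · exact Or.inr (Or.inl hτπ)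
      · refine Or.inl fun x hx => mem_lower.2 ⟨h hx, fun hle => ?_⟩
        rcases Fin.eq_zero_or_eq_succ x with rfl | ⟨i, rfl⟩
        · exact absurd ((broom k n).fin_le_of_le hle) (not_le.2 (Fin.succ_pos _))
        · have := Fin.succ_le_succ_iff.1 ((broom k n).fin_le_of_le hle)
          exact Finset.disjoint_left.1 h1 hx (habove i (hlt.trans_le this) (h hx))
    · exact Or.inr (Or.inl (hτπ.trans h))
    · exact Or.inr (Or.inr (h.mono_right hτπ))
  -- Edges not separated by the new nesting could only have been separated by `ρ`. One of them is
  -- then `b` and the other `a`, but `τ` contains the edge `a` and not `b`.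
  have hsep : Function.Injective ((broom k n).split (insert τ (N.tubes.erase ρ))) := by
    intro x y hxy
    have hag : ∀ σ ∈ insert τ (N.tubes.erase ρ), (broom k n).HasEdge σ x ↔ (broom k n).HasEdge σ y := fun σ hσ =>
      ⟨fun h => (hxy ▸ split_hasEdge _ y : (broom k n).HasEdge _ y).mono (split_subset hσ h),
        fun h => (hxy ▸ split_hasEdge _ x : (broom k n).HasEdge _ x).mono (split_subset hσ h)⟩
    have hagN : ∀ σ ∈ N.tubes, σ ≠ ρ → ((broom k n).HasEdge σ x ↔ (broom k n).HasEdge σ y) := fun σ h h' =>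
      hag σ ((hmem σ).2 (Or.inr ⟨h', h⟩))
    have key : ∀ x y, (∀ σ ∈ insert τ (N.tubes.erase ρ), (broom k n).HasEdge σ x ↔ (broom k n).HasEdge σ y) →
        (broom k n).HasEdge ρ x → (broom k n).HasEdge ρ y := by
      intro x y hag hx
      by_contra hy
      have hagN : ∀ σ ∈ N.tubes, σ ≠ ρ → ((broom k n).HasEdge σ x ↔ (broom k n).HasEdge σ y) := fun σ h h' =>
        hag σ ((hmem σ).2 (Or.inr ⟨h', h⟩))
      have h1 : (broom k n).split N.tubes x = ρ := by
        by_contra hne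
        exact hy (((hagN _ (hN.split_mem x) hne).1 (split_hasEdge _ x)).mono
          (split_subset hρN hx))
      have hxb : x = b := hinj h1
      subst hxb
      have h2 : (broom k n).split N.tubes y ≠ ρ := fun h => hy (h ▸ split_hasEdge _ y)
      have h3 : ρ ⊆ (broom k n).split N.tubes y :=
        split_subset (hN.split_mem y) ((hagN _ (hN.split_mem y) h2).2 (split_hasEdge _ y))
      have h4 : (broom k n).split N.tubes y ⊆ π :=
        split_subset hπN ((hagN π hπN hρπ'.symm).1 hbπ)
      have h5 := (hcov _ (hN.split_mem y) h3 h4).resolve_left h2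
      have hya : y = a := hinj h5
      subst hya
      exact hbτ ((hag τ ((hmem τ).2 (Or.inl rfl))).2 hτa).1
    have hall : ∀ σ ∈ N.tubes, (broom k n).HasEdge σ x ↔ (broom k n).HasEdge σ y := by
      intro σ hσ
      by_cases h : σ = ρ
      · subst h
        exact ⟨key x y hag, key y x fun σ hσ => (hag σ hσ).symm⟩
      · exact hagN σ hσ h
    exact hinj ((split_subset (hN.split_mem y)
      ((hall _ (hN.split_mem y)).2 (split_hasEdge _ y))).antisymm
      (split_subset (hN.split_mem x) ((hall _ (hN.split_mem x)).1 (split_hasEdge _ x))))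
  refine ⟨⟨_, hnest.maximal hsep⟩, ⟨τ, ρ, (hmem τ).2 (Or.inl rfl), hτN, hρN, ?_, ?_, ?_⟩,
    hmem, habove, hmeet⟩
  · intro h
    rcases (hmem ρ).1 h with h | h
    exacts [hτρ h.symm, h.1 rfl]
  · exact Finset.erase_insert fun h => hτN (Finset.mem_of_mem_erase h)
  -- The removed tube exceeds `ρ` only in labels at most `a + 1`, while `ρ` exceeds `τ` only in
  -- vertices above `b + 1`.
  · intro z hz y hy
    rw [Finset.mem_sdiff] at hz hy
    have h1 : z ≤ a.succ := by
      by_contra hc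
      push Not at hc
      rcases Fin.eq_zero_or_eq_succ z with rfl | ⟨i, rfl⟩
      · exact absurd hc (Fin.not_lt_zero _)
      · exact hz.2 (habove i (Fin.succ_lt_succ_iff.1 hc) (hτπ hz.1))
    have h2 : (broom k n).le b.succ y := by
      by_contra hc
      exact hy.2 (mem_lower.2 ⟨hρπ hy.1, hc⟩)
    exact h1.trans_lt ((Fin.succ_lt_succ_iff.2 hlt).trans_le ((broom k n).fin_le_of_le h2))

/-- A permutation below `N.toWeak` whose inversion sets are connected is either `N.toWeak` or below
`M.toWeak` for some `M ⋖ N`. -/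
theorem exists_move_of_edgeInv (N : (broom k n).MaximalNesting) {w : Weak n}
    (hw : ∀ a b c : Fin n, a < b → b < c → (b : ℕ) < n - k → w.EdgeInv a c → w.EdgeInv a b)
    (hle : ∀ a b, w.EdgeInv a b → N.Inv a b) {a b : Fin n} (hab : N.Inv a b)
    (hab' : ¬ w.EdgeInv a b) :
    ∃ M : (broom k n).MaximalNesting, Move M N ∧ ∀ a b, w.EdgeInv a b → M.Inv a b := by
  obtain ⟨a, b, hlt, h1, h2, h3⟩ := Weak.exists_adjacent_inversion
    (P := fun a => w.perm.symm a.rev) (Q := fun a => N.toWeak.perm.symm a.rev)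
    (fun x y h => Fin.rev_injective (w.perm.symm.injective h))
    (fun a b hab h => (N.toWeak_lt_iff).2 (Or.inl (hle a b ⟨hab, h⟩)))
    hab.1 ((N.toWeak_lt_iff).2 (Or.inl hab)) (fun h => hab' ⟨hab.1, h⟩)
  simp only [toWeak_lt_iff] at h1 h3
  have hinv : N.Inv a b := h1.resolve_right fun h => lt_asymm hlt h.1
  obtain ⟨M, hM, hmem, habove, hmeet⟩ := N.exists_move hinv h3
  refine ⟨M, hM, fun x y hxy => ?_⟩
  have hN := N.maximal.prop
  have hNxy := hle x y hxy
  refine ⟨hxy.1, ?_⟩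
  by_contra hc
  have hex := split_hasEdge (T := broom k n) M.tubes x
  rcases (hmem _).1 (M.maximal.prop.split_mem x) with h | h
  · rw [h] at hex hc
    have hexπ := hex.mono (lower_subset _ _)
    have hyπ := split_subset (hN.split_mem a) hexπ hNxy.2
    have hby : (broom k n).le b.succ y.succ := by
      by_contra hle
      exact hc (mem_lower.2 ⟨hyπ, hle⟩)
    have hby' := Fin.succ_le_succ_iff.1 ((broom k n).fin_le_of_le hby)
    have hyρ := habove y (hlt.trans_le hby') hyπ
    -- If `x = a`, either `y = b`, or `b + 1` is strictly below `y + 1`; then `b` is a chain edge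
    -- and the condition on `w` produces the excluded inversion `(a, b)`. If `x ≠ a`, the split of
    -- `x` lies in `ρ` and contains the edge `b`, which forces `x = b`.
    by_cases hxa : x = a
    · subst hxa
      rcases broom_le_iff.1 hby with h4 | h4
      · rw [Fin.succ_inj] at h4
        subst h4
        exact h2 hxy.2
      · exact h2 (hw x b y hlt (Fin.succ_lt_succ_iff.1 h4.1)
          (by simpa [Nat.succ_le_iff] using h4.2) hxy).2
    · have hsub := hmeet x hxa hexπ _ hNxy.2 hyρ
      have hxs := split_hasEdge (T := broom k n) N.tubes x
      have hxb : ¬ (broom k n).le b.succ x.succ := (mem_lower.1 hex.1).2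
      have hedge : (broom k n).HasEdge ((broom k n).split N.tubes x) b := by
        by_contra hne
        rcases (hN.isTube_split x).le_all_or_not_le hne with h5 | h5
        · exact hxb (h5 _ hxs.1)
        · exact h5 _ hNxy.2 hby
      have hxeq := split_injective N.maximal
        (hsub.antisymm (split_subset (hN.split_mem x) hedge))
      exact hxb (hxeq ▸ le_refl _ _)
  · exact hc (split_subset h.2 hex hNxy.2)

/-- The maximal nesting all of whose pairs of edges are inversions. -/
theorem exists_forall_inv (hn : 0 < n) :
    ∃ N : (broom k n).MaximalNesting, ∀ a b, a < b → N.Inv a b := by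
  classical
  set T := broom k n with hT
  -- These sets form a decreasing chain, and `t a` contains exactly the edges `i ≥ a`, so each step
  -- removes one edge.
  let t : Fin n → Finset (Fin (n + 1)) := fun a =>
    Finset.univ.filter fun x => x = T.parent a ∨ a.succ ≤ x
  have ht : ∀ a x, x ∈ t a ↔ x = T.parent a ∨ a.succ ≤ x := by simp [t]
  have hedge : ∀ a i, T.HasEdge (t a) i ↔ a ≤ i := by
    intro a i
    have h1 := broom_parent (k := k) i
    have h2 := broom_parent (k := k) a
    rw [HasEdge, ht, ht]
    simp only [Fin.ext_iff, Fin.le_def, Fin.val_succ, hT, h1, h2]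
    omega
  have hsub : ∀ {a b}, a ≤ b → t b ⊆ t a := by
    intro a b hab x
    have h1 := broom_parent (k := k) b
    have h2 := broom_parent (k := k) a
    rw [ht, ht]
    simp only [Fin.ext_iff, Fin.le_def, Fin.val_succ, hT, h1, h2] at *
    omega
  have hnest : T.IsNesting (Finset.univ.image t) := by
    refine ⟨fun τ hτ => ?_, Finset.mem_image.2 ⟨⟨0, hn⟩, Finset.mem_univ _, ?_⟩, fun τ hτ => ?_,
      fun τ hτ τ' hτ' => ?_⟩
    · obtain ⟨a, -, rfl⟩ := Finset.mem_image.1 hτ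
      refine isTube_of_parent_mem (r := T.parent a) ((ht _ _).2 (Or.inl rfl)) (fun x hx => ?_)
        fun i hi hne => ?_
      · rcases (ht _ _).1 hx with rfl | h
        · exact le_rfl
        · exact (T.parent_lt a).le.trans h
      · have := ((ht _ _).1 hi).resolve_left hne
        exact ((hedge a i).2 (Fin.succ_le_succ_iff.1 this)).2
    · ext x
      have h2 := broom_parent (k := k) (⟨0, hn⟩ : Fin n)
      rw [ht]
      simp only [Fin.ext_iff, Fin.le_def, Fin.val_succ, hT, h2, Finset.mem_univ, iff_true]
      omega
    · obtain ⟨a, -, rfl⟩ := Finset.mem_image.1 hτ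
      exact ((hedge a a).2 le_rfl).two_le_card
    · obtain ⟨a, -, rfl⟩ := Finset.mem_image.1 hτ
      obtain ⟨b, -, rfl⟩ := Finset.mem_image.1 hτ'
      rcases le_total a b with h | h
      · exact Or.inr (Or.inl (hsub h))
      · exact Or.inl (hsub h)
  have hmem : ∀ a, t a ∈ Finset.univ.image t := fun a =>
    Finset.mem_image_of_mem t (Finset.mem_univ a)
  have hle : ∀ {i j}, T.split (Finset.univ.image t) i = T.split (Finset.univ.image t) j → i ≤ j := by
    intro i j hij
    refine (hedge i j).1 ((split_hasEdge (Finset.univ.image t) j).mono ?_)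
    rw [← hij]
    exact split_subset (hmem i) ((hedge i i).2 le_rfl)
  refine ⟨⟨_, hnest.maximal fun i j hij => le_antisymm (hle hij) (hle hij.symm)⟩,
    fun a b hab => ⟨hab, ?_⟩⟩
  obtain ⟨c, -, hc⟩ := Finset.mem_image.1 (hnest.split_mem a)
  have hca : c ≤ a := (hedge c a).1 (hc ▸ split_hasEdge _ a)
  change b.succ ∈ T.split (Finset.univ.image t) a
  rw [← hc]
  exact ((hedge c b).2 (hca.trans hab.le)).1

/-! ### The order on nestings is inclusion of inversions. -/

theorem le_def {T : PlaneTree n} {M N : T.MaximalNesting} :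
    M ≤ N ↔ Relation.ReflTransGen Move M N := Iff.rfl

theorem inv_of_le {T : PlaneTree n} {M N : T.MaximalNesting} (h : M ≤ N) {a b : Fin n}
    (hab : M.Inv a b) : N.Inv a b := by
  induction le_def.1 h with
  | refl => exact hab
  | tail h' hm ih => exact hm.inv (ih h')

/-- Descent: as long as `N` has an inversion absent from `w`, a downward move keeps `w` below, and
the poset of nestings is finite. -/
theorem exists_le_of_edgeInv {w : Weak n}
    (hw : ∀ a b c : Fin n, a < b → b < c → (b : ℕ) < n - k → w.EdgeInv a c → w.EdgeInv a b)
    (N : (broom k n).MaximalNesting) (hle : ∀ a b, w.EdgeInv a b → N.Inv a b) :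
    ∃ M ≤ N, ∀ a b, w.EdgeInv a b ↔ M.Inv a b := by
  induction N using (wellFounded_lt (α := (broom k n).MaximalNesting)).induction with
  | _ N ih =>
    by_cases h : ∃ a b, N.Inv a b ∧ ¬ w.EdgeInv a b
    · obtain ⟨a, b, h1, h2⟩ := h
      obtain ⟨M, hM, hM'⟩ := N.exists_move_of_edgeInv hw hle h1 h2
      have hMN : M ≤ N := Relation.ReflTransGen.single hM
      obtain ⟨M', h3, h4⟩ := ih M (lt_of_le_of_ne hMN fun e => by
        subst e
        exact lt_irrefl _ hM.weight_lt) hM'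
      exact ⟨M', h3.trans hMN, h4⟩
    · push Not at h
      exact ⟨N, le_rfl, fun a b => ⟨hle a b, h a b⟩⟩

theorem Inv.not_hasEdge {T : PlaneTree n} {N : T.MaximalNesting} {a b : Fin n} (h : N.Inv a b) :
    ¬ T.HasEdge (T.split N.tubes b) a := fun he =>
  h.1.ne (split_injective N.maximal
    ((PlaneTree.split_subset (N.maximal.prop.split_mem b) he).antisymm h.split_subset))

/-- Labels above `a + 1` are read off directly from the inversions of `a`. A smaller chain vertex
could be excluded only by a root `d + 1` of the split in `N`, and a smaller leaf only by an
inversion `(i, a)`; transferred to `M`, either one contradicts `Inv.not_hasEdge`. -/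
theorem split_subset_of_inv {M N : (broom k n).MaximalNesting}
    (h : ∀ a b, M.Inv a b ↔ N.Inv a b) (a : Fin n) :
    (broom k n).split M.tubes a ⊆ (broom k n).split N.tubes a := by
  intro x hx
  have hM := M.maximal.prop
  have hN := N.maximal.prop
  have hea := split_hasEdge (T := broom k n) N.tubes a
  have hpa := broom_parent (k := k) a
  rcases lt_trichotomy x a.succ with hlt | rfl | hlt
  · rcases le_or_gt (x : ℕ) (n - k) with hxk | hxk
    · obtain ⟨r, hr, hmin, hcl⟩ := (broom k n).isTube_iff.1 (hN.isTube_split a)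
      rcases le_or_gt r x with hrx | hrx
      · exact (hN.isTube_split a).mem_of_le hr hrx hea.1 (broom_le_iff.2 (Or.inr ⟨hlt, hxk⟩))
      obtain ⟨d, rfl⟩ := Fin.exists_succ_eq.2 (((Fin.zero_le x).trans_lt hrx).ne')
      have hda := hmin _ hea.2
      rw [Fin.le_def, hpa, Fin.val_succ] at hda
      have hlt' : d < a := Fin.lt_def.2 (by omega)
      have hed := split_hasEdge (T := broom k n) N.tubes d
      have hinv : N.Inv d a := ⟨hlt', hN.subset_of_mem (hN.split_mem d) (hN.split_mem a) hed.1 hr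
        hed.2 (fun h => absurd (hmin _ h) (not_le.2 ((broom k n).parent_lt d))) hea.1⟩
      have hdM := (hM.isTube_split a).mem_of_le hx hrx.le (split_hasEdge M.tubes a).1
        (broom_le_succ hlt'.le (by omega))
      exact absurd ⟨hdM, (hM.isTube_split a).parent_mem hdM hx hrx⟩
        ((h d a).2 hinv).not_hasEdge
    · obtain ⟨i, rfl⟩ := Fin.exists_succ_eq.2 (show x ≠ 0 by rintro rfl; simp at hxk)
      have hia := Fin.succ_lt_succ_iff.1 hlt
      have hia' := Fin.lt_def.1 hia
      rw [Fin.val_succ] at hxk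
      have hp : (broom k n).parent i = (broom k n).parent a :=
        Fin.ext (by rw [hpa, broom_parent]; omega)
      have hni : ¬ N.Inv i a := fun hi => by
        refine ((h i a).2 hi).not_hasEdge ⟨hx, ?_⟩
        rw [hp]
        exact (split_hasEdge M.tubes a).2
      have hei := split_hasEdge (T := broom k n) N.tubes i
      exact hN.subset_of_mem (hN.split_mem a) (hN.split_mem i) hea.2 (hp ▸ hei.2) hea.1
        (fun h' => hni ⟨hia, h'⟩) hei.1
  · exact hea.1
  · obtain ⟨i, rfl⟩ := Fin.exists_succ_eq.2 (((Fin.zero_le _).trans_lt hlt).ne')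
    exact ((h a i).1 ⟨Fin.succ_lt_succ_iff.1 hlt, hx⟩).2

/-- Among the edges of `τ`, take one with the largest split. If that split were not all of `τ`, an
edge of `τ` on its boundary would have a larger one. -/
theorem exists_split_eq {T : PlaneTree n} (N : T.MaximalNesting) {τ : Finset (Fin (n + 1))}
    (hτ : τ ∈ N.tubes) : ∃ a, T.split N.tubes a = τ := by
  classical
  have hN := N.maximal.prop
  obtain ⟨e, he⟩ := (hN.isTube τ hτ).exists_edge (hN.two_le_card τ hτ)
  obtain ⟨a, ha, hmax⟩ := (Finset.univ.filter (T.HasEdge τ)).exists_max_image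
    (fun i => (T.split N.tubes i).card) ⟨e, by simpa using he⟩
  simp only [Finset.mem_filter, Finset.mem_univ, true_and] at ha hmax
  refine ⟨a, (PlaneTree.split_subset hτ ha).antisymm ?_⟩
  by_contra hc
  obtain ⟨y, hy, hy'⟩ := Finset.not_subset.1 hc
  obtain ⟨g, hg, hg'⟩ := (hN.isTube τ hτ).exists_crossing
    (T.split N.tubes a : Set (Fin (n + 1))) ha.1 (split_hasEdge _ a).1 hy hy'
  simp only [Finset.mem_coe] at hg'
  have heg := split_hasEdge (T := T) N.tubes g
  have hsub : T.split N.tubes a ⊆ T.split N.tubes g := by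
    rcases hg' with h | h
    · exact hN.subset_of_mem (hN.split_mem g) (hN.split_mem a) heg.1 h.1 heg.2 h.2
    · exact hN.subset_of_mem (hN.split_mem g) (hN.split_mem a) heg.2 h.2 heg.1 h.1
  have heq := Finset.eq_of_subset_of_card_le hsub (hmax g hg)
  rw [← heq] at heg
  rcases hg' with h | h
  exacts [h.2 heg.2, h.1 heg.1]

theorem eq_of_inv {M N : (broom k n).MaximalNesting} (h : ∀ a b, M.Inv a b ↔ N.Inv a b) :
    M = N := by
  have hs : ∀ a, (broom k n).split M.tubes a = (broom k n).split N.tubes a := fun a =>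
    (split_subset_of_inv h a).antisymm (split_subset_of_inv (fun a b => (h a b).symm) a)
  ext τ
  constructor
  · intro hτ
    obtain ⟨a, rfl⟩ := M.exists_split_eq hτ
    exact hs a ▸ N.maximal.prop.split_mem a
  · intro hτ
    obtain ⟨a, rfl⟩ := N.exists_split_eq hτ
    exact hs a ▸ M.maximal.prop.split_mem a

theorem le_iff_inv {M N : (broom k n).MaximalNesting} :
    M ≤ N ↔ ∀ a b, M.Inv a b → N.Inv a b := by
  refine ⟨fun h a b => inv_of_le h, fun h => ?_⟩
  obtain ⟨M', h1, h2⟩ := exists_le_of_edgeInv (w := M.toWeak)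
    (fun a b c hab hbc hb => by
      simp only [edgeInv_toWeak]
      exact fun h => M.broom_inv_of_inv h hab hbc hb) N
    (fun a b hab => h a b ((edgeInv_toWeak M).1 hab))
  have : M = M' := eq_of_inv fun a b => (edgeInv_toWeak M).symm.trans (h2 a b)
  exact this ▸ h1

theorem toWeak_le_toWeak {M N : (broom k n).MaximalNesting} :
    M.toWeak ≤ N.toWeak ↔ M ≤ N := by
  rw [Weak.le_iff_edgeInv, le_iff_inv]
  simp only [edgeInv_toWeak]

theorem exists_toWeak_eq (hn : 0 < n) {w : Weak n}
    (hw : ∀ a b c : Fin n, a < b → b < c → (b : ℕ) < n - k → w.EdgeInv a c → w.EdgeInv a b) :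
    ∃ N : (broom k n).MaximalNesting, N.toWeak = w := by
  obtain ⟨N₀, h₀⟩ := exists_forall_inv (k := k) hn
  obtain ⟨N, -, hN⟩ := exists_le_of_edgeInv hw N₀ fun a b h => h₀ a b h.1
  refine ⟨N, le_antisymm ?_ ?_⟩ <;> rw [Weak.le_iff_edgeInv] <;> intro a b h
  · exact (hN a b).2 ((edgeInv_toWeak N).1 h)
  · exact (edgeInv_toWeak N).2 ((hN a b).1 h)

end PlaneTree.MaximalNesting

/-! ### Inversions of stack-sorted words. -/

theorem List.pair_sublist_append {α : Type*} {a b : α} {l₁ l₂ : List α} :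
    [a, b].Sublist (l₁ ++ l₂) ↔ [a, b].Sublist l₁ ∨ (a ∈ l₁ ∧ b ∈ l₂) ∨ [a, b].Sublist l₂ := by
  rw [List.sublist_append_iff]
  constructor
  · rintro ⟨s₁, s₂, h, h1, h2⟩
    match s₁, s₂, h with
    | [], _, h => exact Or.inr (Or.inr (by rw [List.nil_append] at h; rwa [h]))
    | [x], s₂, h =>
      simp only [List.cons_append, List.nil_append, List.cons.injEq] at h
      obtain ⟨rfl, rfl⟩ := h
      exact Or.inr (Or.inl ⟨List.singleton_sublist.1 h1, List.singleton_sublist.1 h2⟩)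
    | [x, y], s₂, h =>
      simp only [List.cons_append, List.nil_append, List.cons.injEq] at h
      obtain ⟨rfl, rfl, -⟩ := h
      exact Or.inl h1
    | x :: y :: z :: t, s₂, h => simp at h
  · rintro (h | ⟨h1, h2⟩ | h)
    · exact ⟨_, [], by simp, h, List.nil_sublist _⟩
    · exact ⟨[a], [b], rfl, List.singleton_sublist.2 h1, List.singleton_sublist.2 h2⟩
    · exact ⟨[], _, by simp, List.nil_sublist _, h⟩

/-- For `a < b`, the letter `b` precedes `a` in the stack-sorted word if and only if some letter
larger than `b` lies between `b` and `a`. -/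
theorem pair_sublist_stackSort_iff {α : Type*} [LinearOrder α] {w : List α} (hw : w.Nodup)
    {a b : α} (hab : a < b) :
    [b, a].Sublist (stackSort w) ↔ ∃ c, b < c ∧ [b, c, a].Sublist w := by
  induction hl : w.length using Nat.strong_induction_on generalizing w with
  | _ l ih =>
    subst hl
    rw [stackSort]
    split
    · rename_i h
      have hm := List.maximum_of_length_pos_mem h
      have hmax : ∀ x ∈ w, x ≤ w.maximum_of_length_pos h := fun x hx =>
        List.le_maximum_of_length_pos_of_mem hx h
      generalize w.maximum_of_length_pos h = m at hm hmax
      have hi := List.idxOf_lt_length_of_mem hm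
      have e : w = w.take (w.idxOf m) ++ (m :: w.drop (w.idxOf m + 1)) := by
        conv_lhs => rw [← List.take_append_drop (w.idxOf m) w, List.drop_eq_getElem_cons hi]
        simp
      have ih1 := ih (w.take (w.idxOf m)).length (by simp only [List.length_take]; omega)
        (hw.sublist (List.take_sublist _ _)) rfl
      have ih2 := ih (w.drop (w.idxOf m + 1)).length (by simp only [List.length_drop]; omega)
        (hw.sublist (List.drop_sublist _ _)) rfl
      have p1 := fun x => (stackSort_perm (w.take (w.idxOf m))).mem_iff (a := x)
      have p2 := fun x => (stackSort_perm (w.drop (w.idxOf m + 1))).mem_iff (a := x)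
      rw [List.append_assoc, List.pair_sublist_append, List.pair_sublist_append, ih1, ih2, p1,
        List.mem_append, p2]
      clear ih ih1 ih2 p1
      generalize w.take (w.idxOf m) = L at *
      generalize w.drop (w.idxOf m + 1) = R at *
      subst e
      have hne : ∀ x ∈ L, x ≠ m := fun x hx hxm =>
        (List.nodup_append.1 hw).2.2 x hx m List.mem_cons_self hxm
      have hb : ∀ x ∈ L, x < m := fun x hx =>
        lt_of_le_of_ne (hmax x (List.mem_append_left _ hx)) (hne x hx)
      have hbm : b ∈ L ++ m :: R → a ≠ m := fun h hm => absurd (hmax b h) (not_le.2 (hm ▸ hab))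
      constructor
      · rintro (⟨c, hc, hs⟩ | ⟨h1, h2 | h2⟩ | ⟨c, hc, hs⟩ | ⟨h1, h2⟩ | h1)
        · exact ⟨c, hc, hs.trans (List.sublist_append_left _ _)⟩
        -- With `b` left of the maximum and `a` right of it, the maximum is the separating letter.
        · exact ⟨m, hb b h1, List.Sublist.append (List.singleton_sublist.2 h1)
            ((List.singleton_sublist.2 h2).cons_cons m)⟩
        · exact absurd (List.mem_singleton.1 h2) (hbm (List.mem_append_left _ h1))
        · exact ⟨c, hc, (hs.trans (List.sublist_cons_self _ _)).trans
            (List.sublist_append_right _ _)⟩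
        · exact absurd (List.mem_singleton.1 h2)
            (hbm (List.mem_append_right _ (List.mem_cons_of_mem _ ((p2 _).1 h1))))
        · simpa using h1.length_le
      · rintro ⟨c, hc, hs⟩
        have hcm : c ≤ m := hmax c (hs.subset (by simp))
        have ham := hbm (hs.subset (by simp))
        have hbR : b ≠ m := (hc.trans_le hcm).ne
        obtain ⟨s₁, s₂, h, h1, h2⟩ := List.sublist_append_iff.1 hs
        have haR : a ∈ m :: R → a ∈ R := fun h => (List.mem_cons.1 h).resolve_left ham
        match s₁, h with
        | [], h =>
          rw [List.nil_append] at h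
          subst h
          rcases List.sublist_cons_iff.1 h2 with h2 | ⟨r, h2, -⟩
          · exact Or.inr (Or.inr (Or.inl ⟨c, hc, h2⟩))
          · exact absurd (List.cons.inj h2).1 hbR
        | [x], h =>
          simp only [List.cons_append, List.nil_append, List.cons.injEq] at h
          obtain ⟨rfl, rfl⟩ := h
          exact Or.inr (Or.inl ⟨List.singleton_sublist.1 h1, Or.inl (haR (h2.subset (by simp)))⟩)
        | [x, y], h =>
          simp only [List.cons_append, List.nil_append, List.cons.injEq] at h
          obtain ⟨rfl, rfl, rfl⟩ := h
          exact Or.inr (Or.inl ⟨h1.subset (by simp), Or.inl (haR (h2.subset (by simp)))⟩)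
        | [x, y, z], h =>
          simp only [List.cons_append, List.nil_append, List.cons.injEq] at h
          obtain ⟨rfl, rfl, rfl, -⟩ := h
          exact Or.inl ⟨c, hc, h1⟩
        | x :: y :: z :: t :: r, h => simp at h
    · rename_i h
      have : w = [] := List.eq_nil_of_length_eq_zero (by omega)
      simp [this]

namespace Weak

variable {n : ℕ}

theorem oneLine_sort (w : Weak n) : w.sort.oneLine = stackSort w.oneLine := by
  refine List.ext_getElem (by rw [stackSort_oneLine_length]; simp [oneLine]) fun i h1 h2 => ?_
  simp only [oneLine, sort, perm, List.getElem_ofFn, Equiv.ofBijective_apply, List.get_eq_getElem]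
  rfl

theorem pairwise_oneLine (w : Weak n) :
    w.oneLine.Pairwise fun a b => w.perm.symm a < w.perm.symm b := by
  rw [oneLine, List.pairwise_ofFn]
  intro i j hij
  simpa using hij

theorem mem_oneLine (w : Weak n) (a : Fin n) : a ∈ w.oneLine :=
  List.mem_ofFn.2 ⟨w.perm.symm a, by simp⟩

theorem nodup_oneLine (w : Weak n) : w.oneLine.Nodup := List.nodup_ofFn.2 w.perm.injective

theorem sublist_oneLine_iff (w : Weak n) {l : List (Fin n)} :
    l.Sublist w.oneLine ↔ l.Pairwise fun a b => w.perm.symm a < w.perm.symm b := by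
  refine ⟨fun h => w.pairwise_oneLine.sublist h, fun h => ?_⟩
  have hn : l.Nodup := List.Pairwise.imp (fun hab e => hab.ne (congrArg _ e)) h
  have : Std.Antisymm fun a b : Fin n => w.perm.symm a < w.perm.symm b :=
    ⟨fun _ _ h h' => absurd h (lt_asymm h')⟩
  exact List.sublist_of_subperm_of_pairwise (hn.subperm fun a _ => w.mem_oneLine a) h
    w.pairwise_oneLine

/-- `s(w) ≤ w_∘(k, n)` if and only if `w` has no letters `b c a` in this order with `a < b < c` and
`b > k`. -/
theorem sort_le_wCirc_iff (w : Weak n) {k : ℕ} (hkn : k ≤ n) :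
    w.sort ≤ wCirc k n hkn ↔ ∀ a b c : Fin n, a < b → b < c → k ≤ (b : ℕ) →
      w.perm.symm b < w.perm.symm c → ¬ w.perm.symm c < w.perm.symm a := by
  have h1 : ∀ a b : Fin n, a < b → (w.sort.perm.symm b < w.sort.perm.symm a ↔
      ∃ c, b < c ∧ w.perm.symm b < w.perm.symm c ∧ w.perm.symm c < w.perm.symm a) := by
    intro a b hab
    have h2 := pair_sublist_stackSort_iff w.nodup_oneLine hab
    rw [← oneLine_sort, sublist_oneLine_iff] at h2
    simp only [sublist_oneLine_iff, List.pairwise_cons, List.mem_cons, List.not_mem_nil, or_false,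
      forall_eq_or_imp, forall_eq, false_imp_iff, implies_true, and_true, List.Pairwise.nil] at h2
    rw [h2]
    exact exists_congr fun c => ⟨fun h => ⟨h.1, h.2.1.1, h.2.2⟩,
      fun h => ⟨h.1, ⟨h.2.1, h.2.1.trans h.2.2⟩, h.2.2⟩⟩
  have h3 : ∀ a b : Fin n, a < b →
      ((wCirc k n hkn).perm.symm b < (wCirc k n hkn).perm.symm a ↔ (b : ℕ) < k) := by
    intro a b hab
    change (if h : (b : ℕ) < k then (⟨k - 1 - b, by omega⟩ : Fin n) else b) <
      (if h : (a : ℕ) < k then (⟨k - 1 - a, by omega⟩ : Fin n) else a) ↔ _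
    rw [Fin.lt_def] at hab
    split <;> split <;> simp only [Fin.lt_def] <;> omega
  constructor
  · intro h a b c hab hbc hb hbc' hca
    have h4 : (a, b) ∈ w.sort.inversions := ⟨hab, (h1 a b hab).2 ⟨c, hbc, hbc', hca⟩⟩
    have h5 : (a, b) ∈ (wCirc k n hkn).inversions := h h4
    exact absurd ((h3 a b hab).1 h5.2) (not_lt.2 hb)
  · rintro h ⟨a, b⟩ ⟨hab, hba⟩
    obtain ⟨c, hbc, h4, h5⟩ := (h1 a b hab).1 hba
    refine ⟨hab, (h3 a b hab).2 ?_⟩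
    by_contra hb
    exact h a b c hab hbc (not_lt.1 hb) h4 h5

end Weak

namespace Weak

/-- Reversal turns letters `a < b < c` into edges in the opposite order, and the zero-based
condition `k ≤ b` into the condition that the middle edge be a chain edge. Excluding `b c a` means
that `c` before `a` forces `c` before `b`. -/
theorem mem_stackSortPreimage_iff {n k : ℕ} (hkn : k ≤ n) {w : Weak n} :
    w ∈ stackSortPreimage k n hkn ↔ ∀ a b c : Fin n, a < b → b < c → (b : ℕ) < n - k →
      w.EdgeInv a c → w.EdgeInv a b := by
  change w.sort ≤ wCirc k n hkn ↔ _
  rw [sort_le_wCirc_iff]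
  constructor
  · intro h a b c hab hbc hb hac
    refine ⟨hab, ?_⟩
    by_contra hc
    have hne : w.perm.symm a.rev ≠ w.perm.symm b.rev := fun e =>
      hab.ne (Fin.rev_injective (w.perm.symm.injective e))
    exact h c.rev b.rev a.rev (Fin.rev_lt_rev.2 hbc) (Fin.rev_lt_rev.2 hab)
      (by rw [Fin.val_rev]; omega) (lt_of_le_of_ne (not_lt.1 hc) hne.symm) hac.2
  · intro h a b c hab hbc hb h1 h2
    have h3 := h c.rev b.rev a.rev (Fin.rev_lt_rev.2 hbc) (Fin.rev_lt_rev.2 hab)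
      (by rw [Fin.val_rev]; omega) ⟨Fin.rev_lt_rev.2 (hab.trans hbc), by simpa using h2⟩
    exact lt_asymm h1 (by simpa using h3.2)

end Weak

/-! ### Convex sets and factors of words. -/

namespace List

variable {α : Type*}

theorem Pairwise.exists_infix_toFinset_eq [DecidableEq α] {L : List α} {R : α → α → Prop}
    (hL : L.Pairwise R) (S : Finset α) (hS : ∀ x ∈ S, x ∈ L)
    (hconv : ∀ x y z, R x y → R y z → x ∈ S → z ∈ S → y ∈ S) :
    ∃ F : List α, F <:+: L ∧ F.toFinset = S := by
  refine ⟨(L.dropWhile (· ∉ S)).takeWhile (· ∈ S),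
    (takeWhile_prefix _).isInfix.trans (dropWhile_suffix _).isInfix, ?_⟩
  ext x
  rw [mem_toFinset]
  constructor
  · intro hx
    simpa using mem_takeWhile_imp hx
  · intro hx
    have h1 := hS x hx
    rw [← takeWhile_append_dropWhile (p := (· ∉ S)) (l := L), mem_append] at h1
    have h2 : x ∈ L.dropWhile (· ∉ S) := h1.resolve_left fun h => by
      simpa [hx] using mem_takeWhile_imp h
    have hR : (L.dropWhile (· ∉ S)).Pairwise R := hL.sublist (dropWhile_sublist _)
    have hhead : ∀ h, (L.dropWhile (· ∉ S)).head? = some h → h ∈ S := by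
      intro h hh
      have := head?_dropWhile_not (· ∉ S) L
      rw [hh] at this
      simpa using this
    generalize L.dropWhile (· ∉ S) = M at h2 hR hhead
    rw [← takeWhile_append_dropWhile (p := (· ∈ S)) (l := M), mem_append] at h2
    refine h2.resolve_right fun h3 => ?_
    cases hD : M.dropWhile (· ∈ S) with
    | nil => simp [hD] at h3
    | cons y D =>
      have hy : y ∉ S := by
        have := head?_dropWhile_not (· ∈ S) M
        rw [hD] at this
        simpa using this
      rw [← takeWhile_append_dropWhile (p := (· ∈ S)) (l := M), hD] at hR hhead
      rw [hD] at h3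
      cases hT : M.takeWhile (· ∈ S) with
      | nil =>
        rw [hT] at hhead
        exact hy (hhead y (by simp))
      | cons r t =>
        rw [hT] at hR hhead
        have hr := hhead r (by simp)
        have hxD : x ∈ D := (mem_cons.1 h3).resolve_left fun e => hy (e ▸ hx)
        have h4 := (pairwise_append.1 hR).2.2 r (by simp) y (by simp)
        have h5 := (pairwise_cons.1 (pairwise_append.1 hR).2.1).1 x hxD
        exact hy (hconv r y x h4 h5 hr hx)

theorem Pairwise.rel_of_idxOf_lt [DecidableEq α] {L : List α} {R : α → α → Prop}
    (hL : L.Pairwise R) {x y : α} (hy : y ∈ L) (h : L.idxOf x < L.idxOf y) : R x y := by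
  have h1 := idxOf_lt_length_of_mem hy
  have := pairwise_iff_getElem.1 hL _ _ (h.trans h1) h1 h
  simpa using this

theorem Nodup.pairwise_idxOf_lt [DecidableEq α] {L : List α} (h : L.Nodup) :
    L.Pairwise fun x y => L.idxOf x < L.idxOf y := by
  rw [pairwise_iff_getElem]
  intro i j hi hj hij
  rwa [h.idxOf_getElem, h.idxOf_getElem]

theorem mem_of_infix_of_idxOf_lt [DecidableEq α] {L F : List α} (hL : L.Nodup) (hF : F <:+: L)
    {x y z : α} (hx : x ∈ F) (hz : z ∈ F) (hxy : L.idxOf x < L.idxOf y)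
    (hyz : L.idxOf y < L.idxOf z) : y ∈ F := by
  have hp := hL.pairwise_idxOf_lt
  have hyL : y ∈ L := idxOf_lt_length_iff.1
    (hyz.trans (idxOf_lt_length_of_mem (hF.subset hz)))
  obtain ⟨s, t, rfl⟩ := hF
  rw [pairwise_append, pairwise_append] at hp
  rcases mem_append.1 hyL with h | h
  · rcases mem_append.1 h with h | h
    · exact absurd (hp.1.2.2 y h x hx) (lt_asymm hxy)
    · exact h
  · exact absurd (hp.2.2 z (by simp [hz]) y h) (lt_asymm hyz)

end List

/-! ### The unique linearization of a maximal nesting of a broom. -/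

namespace PlaneTree.MaximalNesting

variable {n k : ℕ} (N : (broom k n).MaximalNesting)

/-- The splits of two leaf edges meet at the common parent, so they are nested, and only the larger
one contains both leaves. -/
theorem leaf_mem_split_iff {i j : Fin n} (hij : i ≠ j) (hi : n - k ≤ (i : ℕ))
    (hj : n - k ≤ (j : ℕ)) : j.succ ∈ (broom k n).split N.tubes i ↔ N.Before i j := by
  have hN := N.maximal.prop
  have hp : (broom k n).parent i = (broom k n).parent j :=
    Fin.ext (by rw [broom_parent, broom_parent]; omega)
  have hei := split_hasEdge (T := broom k n) N.tubes i
  have hej := split_hasEdge (T := broom k n) N.tubes j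
  constructor
  · intro h
    rcases lt_or_gt_of_ne hij with hlt | hlt
    · exact Or.inl ⟨hlt, h⟩
    · exact Or.inr ⟨hlt, fun h' => h'.not_hasEdge ⟨h, hp ▸ hei.2⟩⟩
  · rintro (h | ⟨hlt, h⟩)
    · exact h.2
    · exact hN.subset_of_mem (hN.split_mem i) (hN.split_mem j) hei.2 (hp ▸ hej.2) hei.1
        (fun h' => h ⟨hlt, h'⟩) hej.1

theorem not_before_of_before {i j : Fin n} (h : N.Before i j) : ¬ N.Before j i := fun h' =>
  N.not_before_self i (N.before_trans h h')

/-- The vertices of the broom in increasing order of `linKey` form the linearization of `N`: first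
the chain, then the leaves in the order opposite to `Before`. -/
noncomputable def linKey : Fin (n + 1) → ℕ :=
  -- Positions are less than `n`, so `2 * n` minus a position exceeds `n` and hence every chain key,
  -- and it reverses the order of the leaves.
  Fin.cases 0 fun i => if (i : ℕ) < n - k then (i : ℕ) + 1 else 2 * n - N.toWeak.perm.symm i.rev

theorem linKey_zero : N.linKey 0 = 0 := rfl

theorem linKey_of_le {x : Fin (n + 1)} (hx : (x : ℕ) ≤ n - k) : N.linKey x = x := by
  rcases Fin.eq_zero_or_eq_succ x with rfl | ⟨i, rfl⟩
  · rfl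
  · rw [Fin.val_succ] at hx
    simp [linKey, Nat.lt_of_succ_le hx]

theorem linKey_leaf {i : Fin n} (hi : n - k ≤ (i : ℕ)) :
    N.linKey i.succ = 2 * n - N.toWeak.perm.symm i.rev := by
  simp [linKey, not_lt.2 hi]

theorem lt_linKey {x : Fin (n + 1)} (hx : n - k < (x : ℕ)) : n < N.linKey x := by
  rcases Fin.eq_zero_or_eq_succ x with rfl | ⟨i, rfl⟩
  · simp at hx
  · rw [Fin.val_succ] at hx
    rw [N.linKey_leaf (by omega)]
    omega

theorem linKey_leaf_lt_iff {i j : Fin n} (hi : n - k ≤ (i : ℕ)) (hj : n - k ≤ (j : ℕ)) :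
    N.linKey i.succ < N.linKey j.succ ↔ N.Before j i := by
  rw [← toWeak_lt_iff, N.linKey_leaf hi, N.linKey_leaf hj, Fin.lt_def]
  omega

theorem linKey_lt_of_le {x y : Fin (n + 1)} (hx : (x : ℕ) ≤ n - k) (hxy : x < y) :
    N.linKey x < N.linKey y := by
  rw [N.linKey_of_le hx]
  rcases le_or_gt (y : ℕ) (n - k) with h | h
  · rw [N.linKey_of_le h]
    exact hxy
  · exact (by omega : (x : ℕ) ≤ n).trans_lt (N.lt_linKey h)

theorem linKey_injective : Function.Injective N.linKey := by
  have key : ∀ x y : Fin (n + 1), x < y → N.linKey x ≠ N.linKey y := by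
    intro x y hxy
    rcases le_or_gt (x : ℕ) (n - k) with h | h
    · exact (N.linKey_lt_of_le h hxy).ne
    · have hxy' := Fin.lt_def.1 hxy
      obtain ⟨i, rfl⟩ := Fin.exists_succ_eq.2 (show x ≠ 0 by rintro rfl; simp at h)
      obtain ⟨j, rfl⟩ := Fin.exists_succ_eq.2 (((Fin.zero_le _).trans_lt hxy).ne')
      rw [Fin.val_succ] at h
      rw [Fin.val_succ, Fin.val_succ] at hxy'
      have hne : i ≠ j := fun e => hxy.ne (e ▸ rfl)
      rcases N.before_total hne with h' | h'
      · exact ((N.linKey_leaf_lt_iff (by omega) (by omega)).2 h').ne'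
      · exact ((N.linKey_leaf_lt_iff (by omega) (by omega)).2 h').ne
  intro x y h
  by_contra hne
  rcases lt_or_gt_of_ne hne with h' | h'
  · exact key _ _ h' h
  · exact key _ _ h' h.symm

theorem exists_leaf {x : Fin (n + 1)} (hx : n - k < (x : ℕ)) :
    ∃ i : Fin n, x = i.succ ∧ n - k ≤ (i : ℕ) := by
  obtain ⟨i, rfl⟩ := Fin.exists_succ_eq.2 (show x ≠ 0 by rintro rfl; simp at hx)
  exact ⟨i, rfl, by rw [Fin.val_succ] at hx; omega⟩

theorem lt_of_linKey_lt {x y : Fin (n + 1)} (h : N.linKey x < N.linKey y)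
    (hy : (y : ℕ) ≤ n - k) : x < y := by
  rw [N.linKey_of_le hy] at h
  rcases le_or_gt (x : ℕ) (n - k) with h' | h'
  · rwa [N.linKey_of_le h'] at h
  · have := N.lt_linKey h'
    omega

theorem leaf_of_linKey_lt {x y : Fin (n + 1)} (h : N.linKey x < N.linKey y)
    (hx : n - k < (x : ℕ)) : n - k < (y : ℕ) := by
  by_contra hy
  exact absurd (N.lt_of_linKey_lt h (not_lt.1 hy)) (by rw [Fin.lt_def]; omega)

/-- The tubes of `N` are convex with respect to `linKey`. -/
theorem mem_of_linKey_lt {τ : Finset (Fin (n + 1))} (hτ : τ ∈ N.tubes) {x y z : Fin (n + 1)}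
    (hx : x ∈ τ) (hz : z ∈ τ) (hxy : N.linKey x < N.linKey y) (hyz : N.linKey y < N.linKey z) :
    y ∈ τ := by
  have hN := N.maximal.prop
  have ht := hN.isTube τ hτ
  rcases le_or_gt (y : ℕ) (n - k) with hy | hy
  · have h1 := N.lt_of_linKey_lt hxy hy
    have h2 : y < z := by
      rcases le_or_gt (z : ℕ) (n - k) with hz | hz
      · exact N.lt_of_linKey_lt hyz hz
      · exact Fin.lt_def.2 (by omega)
    exact ht.mem_of_le hx h1.le hz (broom_le_iff.2 (Or.inr ⟨h2, hy⟩))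
  · obtain ⟨j, rfl, hj⟩ := exists_leaf (N.leaf_of_linKey_lt hyz hy)
    obtain ⟨i, rfl, hi⟩ := exists_leaf hy
    -- The tube has a second vertex `x`. If `x` has the larger label, it is a leaf with the same
    -- parent as `j + 1`.
    have hej : (broom k n).HasEdge τ j := by
      refine ⟨hz, ?_⟩
      have hxz : x ≠ j.succ := fun e => (hxy.trans hyz).ne (e ▸ rfl)
      rcases lt_or_gt_of_ne hxz with h | h
      · exact ht.parent_mem hz hx h
      · obtain ⟨l, rfl⟩ := Fin.exists_succ_eq.2 (((Fin.zero_le _).trans_lt h).ne')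
        have hp : (broom k n).parent j = (broom k n).parent l := by
          have := Fin.lt_def.1 (Fin.succ_lt_succ_iff.1 h)
          exact Fin.ext (by rw [broom_parent, broom_parent]; omega)
        rw [hp]
        exact ht.parent_mem hx hz h
    have hne : j ≠ i := fun e => hyz.ne (e ▸ rfl)
    exact split_subset hτ hej ((N.leaf_mem_split_iff hne hj hi).2
      ((N.linKey_leaf_lt_iff hi hj).1 hyz))

theorem exists_isLinearization : ∃ L, N.IsLinearization L := by
  let r : Fin (n + 1) → Fin (n + 1) → Prop := fun x y => N.linKey x ≤ N.linKey y
  have : Std.Total r := ⟨fun x y => le_total (N.linKey x) (N.linKey y)⟩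
  have : IsTrans _ r := ⟨fun x y z => le_trans (a := N.linKey x)⟩
  have hperm := List.perm_insertionSort r (List.finRange (n + 1))
  have hnd := hperm.nodup_iff.2 (List.nodup_finRange _)
  have hlt : ((List.finRange (n + 1)).insertionSort r).Pairwise
      fun x y => N.linKey x < N.linKey y :=
    ((List.pairwise_insertionSort r _).and hnd).imp fun h =>
      lt_of_le_of_ne h.1 fun e => h.2 (N.linKey_injective e)
  have hmem : ∀ v, v ∈ (List.finRange (n + 1)).insertionSort r := fun v =>
    hperm.mem_iff.2 (List.mem_finRange v)
  refine ⟨_, hnd, hmem, hlt.imp fun {a b} hab hle => ?_, fun τ hτ =>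
    hlt.exists_infix_toFinset_eq τ (fun x _ => hmem x)
      fun x y z hxy hyz hx hz => N.mem_of_linKey_lt hτ hx hz hxy hyz⟩
  rcases broom_le_iff.1 hle with rfl | h
  · exact lt_irrefl _ hab
  · exact lt_asymm hab (N.linKey_lt_of_le h.2 h.1)

variable {N}

/-- The tree order fixes every comparison that starts at a chain vertex. If the leaf `i` has the
smaller key, the split of `i` contains the parent and `i + 1` but not `j + 1`; being consecutive, it
prevents `j + 1` from standing between them. -/
theorem IsLinearization.pairwise_linKey {L : List (Fin (n + 1))} (hL : N.IsLinearization L) :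
    L.Pairwise fun x y => N.linKey x < N.linKey y := by
  obtain ⟨hnd, hmem, hle, hfac⟩ := hL
  have hN := N.maximal.prop
  have hinj : ∀ {x y}, L.idxOf x = L.idxOf y → x = y := fun {x y} h => (List.idxOf_inj (hmem x)).1 h
  have key0 : ∀ x y : Fin (n + 1), (x : ℕ) ≤ n - k → x < y → L.idxOf x < L.idxOf y := by
    intro x y hx hxy
    by_contra hc
    have hlt := lt_of_le_of_ne (not_lt.1 hc) fun e => hxy.ne (hinj e.symm)
    exact hle.rel_of_idxOf_lt (hmem x) hlt (broom_le_iff.2 (Or.inr ⟨hxy, hx⟩))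
  have key : ∀ x y, N.linKey x < N.linKey y → L.idxOf x < L.idxOf y := by
    intro x y hxy
    rcases le_or_gt (x : ℕ) (n - k) with hx | hx
    · refine key0 x y hx ?_
      rcases le_or_gt (y : ℕ) (n - k) with hy | hy
      · exact N.lt_of_linKey_lt hxy hy
      · exact Fin.lt_def.2 (by omega)
    · obtain ⟨j, rfl, hj⟩ := exists_leaf (N.leaf_of_linKey_lt hxy hx)
      obtain ⟨i, rfl, hi⟩ := exists_leaf hx
      have hne : i ≠ j := fun e => hxy.ne (e ▸ rfl)
      have hnot : j.succ ∉ (broom k n).split N.tubes i := fun h =>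
        N.not_before_of_before ((N.leaf_mem_split_iff hne hi hj).1 h)
          ((N.linKey_leaf_lt_iff hi hj).1 hxy)
      by_contra hc
      have hlt := lt_of_le_of_ne (not_lt.1 hc) fun e => hxy.ne' (congrArg _ (hinj e))
      obtain ⟨F, hF, hFτ⟩ := hfac _ (hN.split_mem i)
      have hei := split_hasEdge (T := broom k n) N.tubes i
      rw [← hFτ] at hnot
      rw [HasEdge, ← hFτ] at hei
      simp only [List.mem_toFinset] at hei hnot
      have hp := broom_parent (k := k) i
      exact hnot (List.mem_of_infix_of_idxOf_lt hnd hF hei.2 hei.1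
        (key0 _ _ (by omega) (by rw [Fin.lt_def, hp, Fin.val_succ]; omega)) hlt)
  refine hnd.pairwise_idxOf_lt.imp fun {x y} h => ?_
  by_contra hc
  rcases lt_or_eq_of_le (not_lt.1 hc) with h' | h'
  · exact lt_asymm h (key _ _ h')
  · rw [N.linKey_injective h'] at h
    exact lt_irrefl _ h

variable (N) in
theorem existsUnique_isLinearization : ∃! L, N.IsLinearization L := by
  obtain ⟨L, hL⟩ := N.exists_isLinearization
  refine ⟨L, hL, fun L' hL' => ?_⟩
  have : Std.Irrefl fun x y : Fin (n + 1) => N.linKey x < N.linKey y := ⟨fun _ => lt_irrefl _⟩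
  have : Std.Antisymm fun x y : Fin (n + 1) => N.linKey x < N.linKey y :=
    ⟨fun _ _ h h' => absurd h (lt_asymm h')⟩
  exact hL'.pairwise_linKey.eq_of_mem_iff hL.pairwise_linKey fun v =>
    iff_of_true (hL'.2.1 v) (hL.2.1 v)

end PlaneTree.MaximalNesting

/-! ### The explicit word and the isomorphism. -/

namespace PlaneTree.MaximalNesting

variable {n k : ℕ} {N : (broom k n).MaximalNesting}

theorem mem_ornament_succ {a : Fin n} {x : Fin (n + 1)} :
    x ∈ N.ornament a.succ ↔ x ∈ (broom k n).split N.tubes a ∧ (broom k n).le a.succ x := by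
  rw [ornament_succ, mem_upper]

theorem self_mem_ornament (a : Fin n) : a.succ ∈ N.ornament a.succ :=
  mem_ornament_succ.2 ⟨(split_hasEdge _ a).1, le_refl _ _⟩

/-- For a chain edge `a` the ornament of `b + 1` is contained in that of `a + 1`; for leaf edges the
ornaments are singletons, compared by `linKey_leaf_lt_iff`. -/
theorem Inv.exists_linKey_le {a b : Fin n} (h : N.Inv a b) {y : Fin (n + 1)}
    (hy : y ∈ N.ornament b.succ) : ∃ x ∈ N.ornament a.succ, N.linKey y ≤ N.linKey x := by
  rw [mem_ornament_succ] at hy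
  rcases lt_or_ge (a : ℕ) (n - k) with ha | ha
  · exact ⟨y, mem_ornament_succ.2 ⟨h.split_subset hy.1, (broom_le_succ h.1.le ha).trans hy.2⟩,
      le_rfl⟩
  · have hab := Fin.lt_def.1 h.1
    have hyb : y = b.succ := by
      rcases broom_le_iff.1 hy.2 with h' | h'
      · exact h'.symm
      · have := h'.2
        rw [Fin.val_succ] at this
        omega
    subst hyb
    exact ⟨_, self_mem_ornament a, ((N.linKey_leaf_lt_iff (by omega) ha).2 (Or.inl h)).le⟩

/-- For a chain edge `a`, a vertex of the ornament keyed after `b + 1` would, by convexity of the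
split, bring `b + 1` into it. -/
theorem linKey_lt_of_not_inv {a b : Fin n} (hab : a < b) (h : ¬ N.Inv a b) {x : Fin (n + 1)}
    (hx : x ∈ N.ornament a.succ) : N.linKey x < N.linKey b.succ := by
  rw [mem_ornament_succ] at hx
  have hab' := Fin.lt_def.1 hab
  have hea := split_hasEdge (T := broom k n) N.tubes a
  rcases lt_or_ge (a : ℕ) (n - k) with ha | ha
  · by_contra hc
    have hne : N.linKey b.succ ≠ N.linKey x := fun e => by
      rw [← N.linKey_injective e] at hx
      exact h ⟨hab, hx.1⟩
    exact h ⟨hab, N.mem_of_linKey_lt (N.maximal.prop.split_mem a) hea.1 hx.1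
      (N.linKey_lt_of_le (by rw [Fin.val_succ]; omega) (Fin.succ_lt_succ_iff.2 hab))
      (lt_of_le_of_ne (not_lt.1 hc) hne)⟩
  · have hxa : x = a.succ := by
      rcases broom_le_iff.1 hx.2 with h' | h'
      · exact h'.symm
      · have := h'.2
        rw [Fin.val_succ] at this
        omega
    subst hxa
    exact (N.linKey_leaf_lt_iff ha (by omega)).2 (Or.inr ⟨hab, h⟩)

/-- If a vertex `u` of `ϱ(a + 1)` comes after the last vertex `v` of `ϱ(b + 1)`, or if `u = v` and
`a < b`, then `a` is before `b`. -/
theorem before_of_linKey_le {a b : Fin n} {u v : Fin (n + 1)} (hu : u ∈ N.ornament a.succ)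
    (hv : v ∈ N.ornament b.succ)
    (hv' : ∀ x ∈ N.ornament b.succ, N.linKey x ≤ N.linKey v)
    (h : N.linKey v < N.linKey u ∨ N.linKey v = N.linKey u ∧ a < b) : N.Before a b := by
  have hne : a ≠ b := by
    rintro rfl
    rcases h with h | h
    · exact absurd (hv' u hu) (not_le.2 h)
    · exact lt_irrefl _ h.2
  refine (N.before_total hne).resolve_right ?_
  rintro (hi | ⟨hab, hi⟩)
  · obtain ⟨x, hx, hux⟩ := hi.exists_linKey_le hu
    have := hv' x hx
    rcases h with h | h
    · omega
    · exact lt_asymm h.2 hi.1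
  · have h1 := linKey_lt_of_not_inv hab hi hu
    have h2 := hv' _ (self_mem_ornament b)
    omega

theorem IsLinearization.eq_cons {L : List (Fin (n + 1))} (hL : N.IsLinearization L) :
    L = 0 :: L.tail := by
  have hp := hL.pairwise_linKey
  have h0 := hL.2.1 0
  match L, hp, h0 with
  | x :: l, hp, h0 =>
    rcases List.mem_cons.1 h0 with rfl | h
    · rfl
    · exact absurd ((List.pairwise_cons.1 hp).1 0 h) (by rw [linKey_zero]; omega)

theorem mem_tail_of_mem_ornament {L : List (Fin (n + 1))} (hL : N.IsLinearization L) {a : Fin n}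
    {x : Fin (n + 1)} (hx : x ∈ N.ornament a.succ) : x ∈ L.tail := by
  have h := hL.2.1 x
  rw [hL.eq_cons] at h
  refine (List.mem_cons.1 h).resolve_left ?_
  rintro rfl
  exact absurd ((broom k n).fin_le_of_le (mem_ornament_succ.1 hx).2) (not_le.2 (Fin.succ_pos _))

/-- The block of `u` collects the letters whose ornament has `u` as its last vertex in the
linearization. -/
theorem IsLinearization.mem_omegaBlock {L : List (Fin (n + 1))} (hL : N.IsLinearization L)
    {u : Fin (n + 1)} (hu : u ∈ L.tail) {j : Fin n} :
    j ∈ omegaBlock L.tail N.ornament u ↔ u ∈ N.ornament j.rev.succ ∧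
      ∀ x ∈ N.ornament j.rev.succ, N.linKey x ≤ N.linKey u := by
  have hp := hL.pairwise_linKey.sublist (List.tail_sublist L)
  have hidx : ∀ x ∈ L.tail, N.linKey u < N.linKey x ↔ L.tail.idxOf u < L.tail.idxOf x := by
    intro x hx
    refine ⟨fun h => ?_, fun h => hp.rel_of_idxOf_lt hx h⟩
    by_contra hc
    rcases lt_or_eq_of_le (not_lt.1 hc) with h' | h'
    · exact lt_asymm h (hp.rel_of_idxOf_lt hu h')
    · rw [(List.idxOf_inj hx).1 h'] at h
      exact lt_irrefl _ h
  have hmem : ∀ x ∈ N.ornament j.rev.succ, x ∈ L.tail := fun _ => mem_tail_of_mem_ornament hL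
  rw [omegaBlock, Finset.mem_sort, Finset.mem_filter]
  simp only [Finset.mem_univ, true_and]
  refine and_congr_right fun _ => ⟨fun h x hx => ?_, fun h x hx hlt hx' => ?_⟩
  · by_contra hc
    exact h x (hmem x hx) ((hidx x (hmem x hx)).1 (not_le.1 hc)) hx
  · exact absurd (h x hx') (not_le.2 ((hidx x hx).2 hlt))

theorem IsLinearization.pairwise_omegaWord {L : List (Fin (n + 1))} (hL : N.IsLinearization L) :
    (omegaWord L.tail N.ornament).Pairwise
      fun i j => N.toWeak.perm.symm i < N.toWeak.perm.symm j := by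
  have key : ∀ i j : Fin n, N.Before i.rev j.rev → N.toWeak.perm.symm i < N.toWeak.perm.symm j := by
    intro i j h
    have := N.toWeak_lt_iff.2 h
    simpa using this
  have hp := hL.pairwise_linKey.sublist (List.tail_sublist L)
  rw [omegaWord, List.pairwise_flatMap]
  constructor
  · intro u hu
    rw [List.mem_reverse] at hu
    refine List.Pairwise.imp_of_mem ?_ (Finset.sortedGT_sort _).pairwise
    intro i j hi hj hij
    rw [hL.mem_omegaBlock hu] at hi hj
    exact key i j (before_of_linKey_le hi.1 hj.1 hj.2 (Or.inr ⟨rfl, Fin.rev_lt_rev.2 hij⟩))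
  · rw [List.pairwise_reverse]
    refine hp.imp_of_mem ?_
    intro v u hv hu hvu i hi j hj
    rw [hL.mem_omegaBlock hu] at hi
    rw [hL.mem_omegaBlock hv] at hj
    exact key i j (before_of_linKey_le hi.1 hj.1 hj.2 (Or.inl hvu))

theorem IsLinearization.mem_omegaWord {L : List (Fin (n + 1))} (hL : N.IsLinearization L)
    (j : Fin n) : j ∈ omegaWord L.tail N.ornament := by
  obtain ⟨u, hu, hmax⟩ := (N.ornament j.rev.succ).exists_max_image N.linKey
    ⟨_, self_mem_ornament _⟩
  have hu' := mem_tail_of_mem_ornament hL hu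
  exact List.mem_flatMap.2 ⟨u, List.mem_reverse.2 hu', (hL.mem_omegaBlock hu').2 ⟨hu, hmax⟩⟩

/-- Both words contain every letter and are strictly increasing in position under `N.toWeak`, hence
they coincide. -/
theorem IsLinearization.oneLine_toWeak {L : List (Fin (n + 1))} (hL : N.IsLinearization L) :
    N.toWeak.oneLine = omegaWord L.tail N.ornament := by
  have : Std.Irrefl fun i j : Fin n => N.toWeak.perm.symm i < N.toWeak.perm.symm j :=
    ⟨fun _ => lt_irrefl _⟩
  have : Std.Antisymm fun i j : Fin n => N.toWeak.perm.symm i < N.toWeak.perm.symm j :=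
    ⟨fun _ _ h h' => absurd h (lt_asymm h')⟩
  exact N.toWeak.pairwise_oneLine.eq_of_mem_iff hL.pairwise_omegaWord fun j =>
    iff_of_true (N.toWeak.mem_oneLine j) (hL.mem_omegaWord j)

/-- The isomorphism from `MN(Broom_{k,n})` to `s⁻¹(Δ(w_∘(k, n)))`. -/
noncomputable def broomIso (k n : ℕ) (hk : 1 ≤ k) (hkn : k ≤ n) :
    (broom k n).MaximalNesting ≃o Weak.stackSortPreimage k n hkn where
  toEquiv := Equiv.ofBijective
    (fun N => ⟨N.toWeak, (Weak.mem_stackSortPreimage_iff hkn).2 fun a b c hab hbc hb => by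
      simp only [edgeInv_toWeak]
      exact fun h => N.broom_inv_of_inv h hab hbc hb⟩)
    ⟨fun M N h => by
      have h' : M.toWeak = N.toWeak := congrArg Subtype.val h
      exact le_antisymm (toWeak_le_toWeak.1 h'.le) (toWeak_le_toWeak.1 h'.ge),
    fun w => by
      obtain ⟨N, hN⟩ := exists_toWeak_eq (k := k) (hk.trans hkn)
        ((Weak.mem_stackSortPreimage_iff hkn).1 w.2)
      exact ⟨N, Subtype.ext hN⟩⟩
  map_rel_iff' := toWeak_le_toWeak

end PlaneTree.MaximalNesting

theorem theorem1p5 (k n : ℕ) (hk : 1 ≤ k) (hkn : k ≤ n) :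
    ∃ e : (PlaneTree.broom k n).MaximalNesting ≃o Weak.stackSortPreimage k n hkn,
      ∀ N : (PlaneTree.broom k n).MaximalNesting,
        (∃! L : List (Fin (n + 1)), N.IsLinearization L) ∧
        ∀ L : List (Fin (n + 1)), N.IsLinearization L →
          (e N : Weak n).oneLine = omegaWord L.tail N.ornament :=
  ⟨PlaneTree.MaximalNesting.broomIso k n hk hkn, fun N =>
    ⟨N.existsUnique_isLinearization, fun _ hL => hL.oneLine_toWeak⟩⟩
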